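/- Let $(K,E)$ be a proper pair of algebraically closed fields ($E\subsetneq K$), viewed as a structure in the language $\mathcal L_P$ of rings together with a unary predicate $P$ with $P(K)=E$. Suppose that $(K,E)$ is sufficiently saturated: $\kappa$-saturated for some uncountable cardinal $\kappa$, where subfields taken as parameter sets are required to have cardinality less than $\kappa$. For $n\ge 1$ and $1\le i\le n$, let $\lambda^i_n(a_0;a_1,\dots,a_n)\in E$ be the coefficient of $a_i$ in the unique expression of $a_0$ as an $E$-linear combination of $a_1,\dots,a_n$, if $a_1,\dots,a_n$ are $E$-linearly independent and $a_0$ lies in their $E$-span, and $0$ otherwise. For $A\subseteq K$ let $\lambda(A)$ be the subfield of $E$ generated by all values of these functions at tuples from $A$. A subfield $k$ of $K$ is $\lambda$-closed if $\lambda(k)\subseteq k$. For a subfield $k$ and a finite tuple $a$ of $K$ put \[\mathrm{rk}(a/k)=\omega\cdot \mathrm{tr}(a/E\cdot k)+\mathrm{tr}\bigl(\lambda(k(a))/\lambda(k)\bigr),\] an ordinal, where $\mathrm{tr}$ denotes transcendence degree and $E\cdot k$ the compositum. A tame formula in the variables $x$ is an $\mathcal L_P$-formula of the form \[\exists\,\zeta\in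 P^r\Bigl(\neg\,\zeta\doteq 0\;\land\;\bigwedge_{j=1}^m q_j(x,\zeta)\doteq 0\Bigr)\] with polynomials $q_1,\dots,q_m\in\mathbb Z[X,Z]$ homogeneous in the variables $Z$; an instance of it over $k$ is obtained by substituting elements of $k$ for some of the variables $x$. Write $\mathrm{tp}_P(a/k)$ for the $\mathcal L_P$-type of $a$ over $k$. Let $k$ be a $\lambda$-closed subfield of $K$ with $|k|<\kappa$ and let $a$ be a finite tuple of $K$. Then there is an instance $\chi$, over $k$, of a tame formula, with $\chi\in\mathrm{tp}_P(a/k)$, such that for every realisation $b$ of $\chi$ in $K$ \[\mathrm{rk}(b/k)\le \mathrm{rk}(a/k),\qquad\text{and}\qquad \mathrm{rk}(b/k)=\mathrm{rk}(a/k)\iff \mathrm{tp}_P(b/k)=\mathrm{tp}_P(a/k).\] -/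

import Mathlib

open FirstOrder FirstOrder.Language

universe u

namespace ACFPair

/-! ### The language of pairs and the structure `(K, E)` -/

/-- Relation symbols of the language with just one unary predicate `P`. -/
inductive PredRel : ℕ → Type
  | P : PredRel 1

/-- The language whose only symbol is the unary predicate `P`. -/
def predLang : FirstOrder.Language.{0, 0} := ⟨fun _ => Empty, PredRel⟩

/-- The language `L_P` of pairs: the language of rings together with a unary predicate `P`. -/
def pairLang : FirstOrder.Language.{0, 0} := FirstOrder.Language.ring.sum predLang

/-- The predicate symbol `P` of `L_P`. -/
def predP : pairLang.Relations 1 := Sum.inr PredRel.P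

variable {K : Type u} [Field K]

/-- The structure on `K` in which the symbol `P` is interpreted by the subfield `E`. -/
@[reducible] def predStructure (E : Subfield K) : predLang.Structure K where
  funMap := fun f => nomatch f
  RelMap := fun R x => match R, x with
    | PredRel.P, x => x 0 ∈ E

/-- The `L_P`-structure `(K, E)`: the field `K` with `P(K) = E`. -/
@[reducible] def pairStructure (E : Subfield K) : pairLang.Structure K :=
  letI : FirstOrder.Language.ring.Structure K := (FirstOrder.Ring.compatibleRingOfRing K).toStructure
  letI : predLang.Structure K := predStructure E
  FirstOrder.Language.sumStructure FirstOrder.Language.ring predLang K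

/-- `(K, E) ⊨ χ(b)`, for an `L_P`-formula `χ` with parameters in `A`. -/
def Realizes (E : Subfield K) (A : Set K) {n : ℕ} (χ : pairLang[[A]].Formula (Fin n))
    (b : Fin n → K) : Prop :=
  letI := pairStructure E
  χ.Realize b

/-- The type `tp_P(a/A)`: all `L_P`-formulae with parameters in `A` satisfied by `a`. -/
def tpP (E : Subfield K) (A : Set K) {n : ℕ} (a : Fin n → K) :
    Set (pairLang[[A]].Formula (Fin n)) :=
  {χ | Realizes E A χ a}

/-- The pair `(K, E)` is `κ`-saturated: over every set `A` of fewer than `κ` parameters, every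
finitely satisfiable set of `L_P`-formulae over `A` in one variable is realised in `K`. -/
def IsSaturated (E : Subfield K) (κ : Cardinal.{u}) : Prop :=
  ∀ A : Set K, Cardinal.mk A < κ → ∀ p : Set (pairLang[[A]].Formula (Fin 1)),
    (∀ s : Finset (pairLang[[A]].Formula (Fin 1)), (s : Set _) ⊆ p →
      ∃ v : Fin 1 → K, ∀ χ ∈ s, Realizes E A χ v) →
    ∃ v : Fin 1 → K, ∀ χ ∈ p, Realizes E A χ v

/-! ### Tame formulae -/

/-- A polynomial with integer coefficients, as a term of `L_P`. -/
noncomputable def polyTerm {β : Type} (q : MvPolynomial β ℤ) : pairLang.Term β :=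
  (LHom.sumInl : FirstOrder.Language.ring →ᴸ FirstOrder.Language.ring.sum predLang).onTerm
    (FirstOrder.Ring.termOfFreeCommRing ((freeCommRingEquivMvPolynomialInt β).symm q))

/-- `q(X, Z)` is homogeneous in the variables `Z`. -/
def HomogeneousInZ {α : Type} {r : ℕ} (q : MvPolynomial (α ⊕ Fin r) ℤ) : Prop :=
  ∃ d : ℕ, MvPolynomial.IsWeightedHomogeneous
    (Sum.elim (fun _ => 0) (fun _ => 1) : α ⊕ Fin r → ℕ) q d

/-- The formula `∃ ζ ∈ P^r (¬ ζ ≐ 0 ∧ ⋀ j, q_j(x, ζ) ≐ 0)`. -/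
noncomputable def tameFormula {α : Type} (r m : ℕ)
    (q : Fin m → MvPolynomial (α ⊕ Fin r) ℤ) : pairLang.Formula α :=
  Formula.iExs (Fin r)
    ((Formula.iInf fun i : Fin r => predP.formula₁ (Term.var (Sum.inr i))) ⊓
      (∼(Formula.iInf fun i : Fin r =>
          Term.equal (Term.var (Sum.inr i)) (polyTerm (0 : MvPolynomial (α ⊕ Fin r) ℤ))) ⊓
        Formula.iInf fun j : Fin m => Term.equal (polyTerm (q j)) (polyTerm 0)))

/-- Tame formulae in the variables `x = (x_i)_{i ∈ α}`. -/
def IsTame {α : Type} (φ : pairLang.Formula α) : Prop :=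
  ∃ (r m : ℕ) (q : Fin m → MvPolynomial (α ⊕ Fin r) ℤ),
    (∀ j, HomogeneousInZ (q j)) ∧ φ = tameFormula r m q

/-- The instance `φ(x, c)` of the formula `φ(x, y)`, for a tuple `c` of parameters in `A`. -/
def instanceAt (A : Set K) {n l : ℕ} (φ : pairLang.Formula (Fin n ⊕ Fin l)) (c : Fin l → A) :
    pairLang[[A]].Formula (Fin n) :=
  BoundedFormula.subst ((pairLang.lhomWithConstants A).onFormula φ)
    (Sum.elim (fun i => Term.var i) (fun i => (pairLang.con (c i)).term))

/-- `χ` is an instance, with parameters in `A`, of a tame formula. -/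
def IsTameInstance (A : Set K) {n : ℕ} (χ : pairLang[[A]].Formula (Fin n)) : Prop :=
  ∃ (l : ℕ) (φ : pairLang.Formula (Fin n ⊕ Fin l)) (c : Fin l → A),
    IsTame φ ∧ χ = instanceAt A φ c

/-! ### The `λ`-functions -/

open Classical in
/-- The value `λ_n^i(a₀; a₁, …, a_n)`: if `a₁, …, a_n` are `E`-linearly independent and `a₀` lies
in their `E`-span, it is the coefficient of `a_i` in `a₀`; otherwise it is zero. -/
noncomputable def lambdaFun (E : Subfield K) {n : ℕ} (i : Fin n) (a₀ : K) (a : Fin n → K) : K :=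
  if h : LinearIndependent E a ∧ a₀ ∈ Submodule.span E (Set.range a) then
    ((h.1.repr ⟨a₀, h.2⟩ i : E) : K)
  else 0

/-- `λ(A)`: the subfield generated by the values of the `λ`-functions at tuples of `A`. -/
noncomputable def lambda (E : Subfield K) (A : Set K) : Subfield K :=
  Subfield.closure {c | ∃ (n : ℕ) (i : Fin n) (a₀ : K) (a : Fin n → K),
    a₀ ∈ A ∧ (∀ j, a j ∈ A) ∧ c = lambdaFun E i a₀ a}

/-- The subfield `k` is `λ`-closed in `(K, E)`. -/
def IsLambdaClosed (E k : Subfield K) : Prop := lambda E (k : Set K) ≤ k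

/-! ### The rank -/

/-- `tr(S/F)`: the transcendence degree over `F` of the field generated by `S` over `F`. -/
noncomputable def tr (S : Set K) (F : Subfield K) : Cardinal.{u} :=
  Algebra.trdeg F (IntermediateField.adjoin F S)

/-- The subfield `k(a)` generated by `k` and the tuple `a`. -/
def adjoinTuple (k : Subfield K) {n : ℕ} (a : Fin n → K) : Subfield K :=
  Subfield.closure ((k : Set K) ∪ Set.range a)

/-- `rk(a/k) = ω · tr(a / E·k) + tr(λ(k(a)) / λ(k))`, an ordinal. -/
noncomputable def rk (E k : Subfield K) {n : ℕ} (a : Fin n → K) : Ordinal.{u} :=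
  Ordinal.omega0 * (tr (Set.range a) (E ⊔ k)).ord +
    (tr (lambda E (adjoinTuple k a : Set K) : Set K) (lambda E (k : Set K))).ord

end ACFPair

/-!
Write `acl` for relative algebraic closure in `K` and `F = λ(k)`, which equals `k ∩ E` because `k`
is `λ`-closed. Two facts carry the proof.

*Types are controlled by algebraic isomorphisms.* Call a subfield `L` free if `L` and `E` are
algebraically independent over `L ∩ E` (`IsFree`). A `λ`-closed field is free: it is linearly
disjoint from `E` over its intersection with `E`. Freeness survives adjoining elements of `E` and
elements transcendental over `E · L`. Saturation provides new elements of both kinds over any small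
field (`IsSaturated.isRich`); the second kind exists because, for `t ∉ E` and a valuation that is
trivial on `E` but not at `t`, the elements `t ^ (N i) * c` with `i ≤ d`, and `c` in a finite
`E`-independent set, are `E`-independent for large `N`. Hence isomorphisms between small,
algebraically closed, free subfields which preserve `E` and fix `k` form a back-and-forth system,
so they preserve types over `k` (`IsAdmissible.tpP_eq`). The same extension property shows that
such subfields are `λ`-closed (`IsFree.isLambdaClosed`): a coefficient outside the field could be
moved, contradicting uniqueness of coefficients.

*Tame instances express specialisation.* By Noetherianity, any family of polynomials over `k` that
are homogeneous in `Z` defines a single tame instance (`exists_isTameInstance`). Let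
`d = tr(a / E · k)`. Each set `S` of `d + 1` coordinates of `a` is algebraically dependent over
`E · k`, and clearing denominators turns this into a relation with a non-zero coefficient vector
`c_S` from `λ(k(a))`. Let `ζ` be the Segre product of all the vectors `c_S`
(`exists_coordinates`), and let `χ` say that some non-zero `ζ'` in `E` satisfies every homogeneous
equation over `k` valid at `(a, ζ)`. For a realisation `b` of `χ`, witnessed by `ζ'`, one
non-vanishing coordinate of `ζ'` shows that all the relations persist with coefficients in
`k(η')`, where `η'` and `η` denote the dehomogenisations of `ζ'` and `ζ`. So `tr(b / E · k) ≤ d`.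
If equality holds, `acl(k, η', b)` is free and meets `E` in `acl(F, η')`, hence
`tr(λ(k(b)) / F) ≤ tr(η' / F) ≤ tr(η / F) ≤ tr(λ(k(a)) / F)`, which bounds the rank. If the ranks
agree, then `(a, η)` and its specialisation `(b, η')` have the same transcendence degree over `k`,
so they satisfy the same equations over `k`, and the resulting isomorphism of algebraic closures is
admissible; thus `a` and `b` have the same type (`tpP_eq_of_specializes`). Conversely, if the types
agree, then `a` realises the tame instance attached to `b` as well, and the rank inequality holds
in both directions.
-/

namespace ACFPair

open Cardinal AlgebraicIndependent

variable {K : Type u} [Field K]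

/-! ### Relative algebraic closure and transcendence degree -/

/-- The field-theoretic algebraic closure in `K` of the subfield generated by `S`. -/
def acl (S : Set K) : Subfield K := (algebraicClosure (Subfield.closure S) K).toSubfield

lemma mem_acl {S : Set K} {x : K} : x ∈ acl S ↔ IsAlgebraic (Subfield.closure S) x := by
  change x ∈ algebraicClosure (Subfield.closure S) K ↔ _
  exact mem_algebraicClosure_iff

lemma mem_acl_union_iff (M : Subfield K) (S : Set K) {x : K} :
    x ∈ acl ((M : Set K) ∪ S) ↔ IsAlgebraic (Algebra.adjoin M S) x := by
  have h1 : IsAlgebraic (Algebra.adjoin M S) x ↔ IsAlgebraic (IntermediateField.adjoin M S) x := by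
    open scoped IntermediateField.algebraAdjoinAdjoin in
    exact IsFractionRing.isAlgebraic_iff (Algebra.adjoin M S) (IntermediateField.adjoin M S) K
  rw [h1, mem_acl]
  have h2 : Subfield.closure ((M : Set K) ∪ S) = (IntermediateField.adjoin M S).toSubfield := by
    change _ = Subfield.closure _
    congr 2
    exact Subtype.range_coe.symm
  rw [h2]
  rfl

lemma coe_acl_union (M : Subfield K) (S : Set K) :
    ((acl ((M : Set K) ∪ S) : Subfield K) : Set K) = (matroid M K).closure S := by
  rw [matroid_closure_eq]
  ext x
  exact mem_acl_union_iff M S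

lemma coe_acl (S : Set K) :
    ((acl S : Subfield K) : Set K) = (matroid (⊥ : Subfield K) K).closure S := by
  rw [← coe_acl_union]
  have : acl (((⊥ : Subfield K) : Set K) ∪ S) = acl S := by
    have h : Subfield.closure (((⊥ : Subfield K) : Set K) ∪ S) = Subfield.closure S := by
      rw [Subfield.closure_union, Subfield.closure_eq, bot_sup_eq]
    unfold acl
    rw [h]
  rw [this]

lemma subset_acl (S : Set K) : S ⊆ acl S := by
  rw [coe_acl]; exact Matroid.subset_closure _ _

lemma acl_mono {S T : Set K} (h : S ⊆ T) : acl S ≤ acl T := by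
  rw [← SetLike.coe_subset_coe, coe_acl, coe_acl]
  exact Matroid.closure_subset_closure _ h

lemma acl_le {S T : Set K} (h : S ⊆ acl T) : acl S ≤ acl T := by
  rw [← SetLike.coe_subset_coe, coe_acl, coe_acl]
  rw [coe_acl] at h
  exact Matroid.closure_subset_closure_of_subset_closure h

lemma acl_acl (S : Set K) : acl (acl S : Set K) = acl S :=
  le_antisymm (acl_le le_rfl) (acl_mono (subset_acl S))

lemma acl_union_le {S T U : Set K} (h : S ⊆ acl U) (h' : T ⊆ acl U) : acl (S ∪ T) ≤ acl U :=
  acl_le (Set.union_subset h h')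

/-- The exchange property of `acl`. -/
lemma acl_exchange {S : Set K} {x y : K} (h : x ∈ acl (insert y S)) (hx : x ∉ acl S) :
    y ∈ acl (insert x S) := by
  rw [← SetLike.mem_coe, coe_acl] at *
  exact Matroid.mem_closure_insert hx h

lemma exists_finite_of_mem_acl {S : Set K} {x : K} (h : x ∈ acl S) :
    ∃ T ⊆ S, T.Finite ∧ x ∈ acl T := by
  rw [← SetLike.mem_coe, coe_acl] at h
  obtain ⟨I, hIS, hI, -, hxI⟩ := Matroid.exists_mem_finite_closure_of_mem_closure h
  refine ⟨I, hIS, hI, ?_⟩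
  rw [← SetLike.mem_coe, coe_acl]; exact hxI

lemma acl_eq_self_of_isAlgClosed (E : Subfield K) [IsAlgClosed E] : acl (E : Set K) = E := by
  refine le_antisymm (fun x hx => ?_) (subset_acl _)
  rw [mem_acl, Subfield.closure_eq] at hx
  obtain ⟨y, rfl⟩ := minpoly.mem_range_of_degree_eq_one E x
    (IsAlgClosed.degree_eq_one_of_irreducible E (minpoly.irreducible hx.isIntegral))
  exact y.2

lemma isAlgClosed_of_acl_eq_self [IsAlgClosed K] {L : Subfield K} (h : acl (L : Set K) = L) :
    IsAlgClosed L := by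
  refine IsAlgClosed.of_exists_root _ fun p _ hp => ?_
  obtain ⟨x, hx⟩ := IsAlgClosed.exists_aeval_eq_zero K p
    (Polynomial.degree_pos_of_irreducible hp).ne'
  have hxL : x ∈ L := by
    rw [← h, mem_acl, Subfield.closure_eq]
    exact ⟨p, hp.ne_zero, hx⟩
  refine ⟨⟨x, hxL⟩, ?_⟩
  have : (algebraMap L K) (p.eval ⟨x, hxL⟩) = 0 := by
    rw [← Polynomial.aeval_algebraMap_apply_eq_algebraMap_eval]; exact hx
  simpa using this

lemma mk_acl_le (S : Set K) : #(acl S) ≤ max #S ℵ₀ := by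
  have h1 := Algebra.IsAlgebraic.cardinalMk_le_max (Subfield.closure S)
    (algebraicClosure (Subfield.closure S) K)
  have h2 := Subfield.cardinalMk_closure_le_max S
  exact h1.trans (max_le h2 (le_max_right _ _))

lemma mem_acl_map_iff {A B : Type*} [Field A] [Field B] (g : A →+* B) (S : Set A) (x : A) :
    g x ∈ acl (g '' S) ↔ x ∈ acl S := by
  rw [mem_acl, mem_acl]
  have hg : ∀ y : Subfield.closure S, g y ∈ Subfield.closure (g '' S) := fun y => by
    rw [← g.map_field_closure]; exact ⟨y, y.2, rfl⟩
  let e : Subfield.closure S ≃+* Subfield.closure (g '' S) :=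
    RingEquiv.ofBijective ((g.comp (Subfield.closure S).subtype).codRestrict _ hg) (by
      refine ⟨RingHom.injective _, fun y => ?_⟩
      obtain ⟨z, hz, hzy⟩ : (y : B) ∈ (Subfield.closure S).map g :=
        (g.map_field_closure S).symm ▸ y.2
      exact ⟨⟨z, hz⟩, Subtype.ext hzy⟩)
  exact isAlgebraic_ringHom_iff_of_comp_eq e g g.injective rfl

lemma algebraicIndepOn_insert_iff (M : Subfield K) {ι : Type*} {x : ι → K} {T : Set ι} {i : ι}
    (hi : i ∉ T) : AlgebraicIndepOn M x (insert i T) ↔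
      AlgebraicIndepOn M x T ∧ x i ∉ acl ((M : Set K) ∪ x '' T) := by
  rw [AlgebraicIndepOn.insert_iff hi, mem_acl_union_iff]; rfl

lemma algebraicIndepOn_empty (M : Subfield K) {ι : Type*} (x : ι → K) :
    AlgebraicIndepOn M x ∅ :=
  algebraicIndependent_empty_type_iff.mpr (algebraMap M K).injective

lemma AlgebraicIndepOn.mono_base {M N : Subfield K} (h : M ≤ N) {ι : Type*} {x : ι → K}
    {T : Set ι} (hT : AlgebraicIndepOn N x T) : AlgebraicIndepOn M x T := by
  let := (Subfield.inclusion h).toAlgebra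
  have : IsScalarTower M N K := IsScalarTower.of_algebraMap_eq fun _ => rfl
  exact AlgebraicIndependent.restrictScalars (Subfield.inclusion h).injective hT

/-- The matroid of algebraic independence over `M` makes `tr` amenable to rank arguments. -/
lemma tr_eq_cRk (S : Set K) (M : Subfield K) : tr S M = (matroid M K).cRk S := by
  obtain ⟨B, hB⟩ := (matroid M K).exists_isBasis S
  rw [← hB.cardinalMk_eq_cRk]
  have hN : ∀ y ∈ IntermediateField.adjoin M S, y ∈ (matroid M K).closure S := by
    intro y hy
    rw [← coe_acl_union, SetLike.mem_coe, mem_acl]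
    have h2 : Subfield.closure ((M : Set K) ∪ S) = (IntermediateField.adjoin M S).toSubfield := by
      change _ = Subfield.closure _
      congr 2
      exact Subtype.range_coe.symm
    rw [h2]
    exact isAlgebraic_algebraMap (⟨y, hy⟩ : IntermediateField.adjoin M S)
  let x : B → IntermediateField.adjoin M S := fun b =>
    ⟨b, IntermediateField.subset_adjoin M S (hB.subset b.2)⟩
  have hx : IsTranscendenceBasis M x := by
    refine ⟨AlgebraicIndependent.of_comp (IntermediateField.val _) hB.indep, fun s hs hxs => ?_⟩
    have hs' : (matroid M K).Indep (((↑) : IntermediateField.adjoin M S → K) '' s) := by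
      rw [matroid_indep_iff]
      refine (algebraicIndependent_image (R := M) Subtype.val_injective.injOn).1 ?_
      exact hs.map' (f := IntermediateField.val _) Subtype.val_injective
    have hBs : B = ((↑) : IntermediateField.adjoin M S → K) '' s := by
      refine hB.isBasis_closure_right.eq_of_subset_indep hs' (fun b hb => ?_) ?_
      · exact ⟨x ⟨b, hb⟩, hxs ⟨⟨b, hb⟩, rfl⟩, rfl⟩
      · rintro _ ⟨y, -, rfl⟩
        exact hN y y.2
    refine hxs.antisymm fun y hy => ?_
    have : (y : K) ∈ B := by rw [hBs]; exact ⟨y, hy, rfl⟩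
    exact ⟨⟨y, this⟩, rfl⟩
  exact hx.cardinalMk_eq_trdeg.symm

lemma tr_le_of_subset_acl {S T : Set K} {M : Subfield K} (h : S ⊆ acl ((M : Set K) ∪ T)) :
    tr S M ≤ tr T M := by
  rw [tr_eq_cRk, tr_eq_cRk, ← Matroid.cRk_closure _ T]
  rw [coe_acl_union] at h
  exact Matroid.cRk_le_of_subset _ h

lemma mk_image_coe_finset {ι : Type*} {α : Type u} {x : ι → α} {T : Finset ι} (h : Set.InjOn x T) :
    #(x '' T) = T.card := by
  classical
  rw [← Finset.coe_image]
  exact mk_coe_finset.trans (by rw [Finset.card_image_of_injOn h])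

lemma AlgebraicIndepOn.card_le_tr {M : Subfield K} {ι : Type*} {x : ι → K} {T : Finset ι}
    (hT : AlgebraicIndepOn M x T) {S : Set K} (hS : x '' T ⊆ acl ((M : Set K) ∪ S)) :
    (T.card : Cardinal) ≤ tr S M := by
  have hinj : Set.InjOn x T := fun i hi j hj hij =>
    congrArg Subtype.val (hT.injective (a₁ := ⟨i, hi⟩) (a₂ := ⟨j, hj⟩) hij)
  have h : (matroid M K).Indep (x '' T) := by
    rw [matroid_indep_iff]
    exact (algebraicIndependent_image (R := M) hinj).1 hT
  rw [coe_acl_union] at hS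
  have := h.cardinalMk_le_cRk_of_subset hS
  rwa [Matroid.cRk_closure, ← tr_eq_cRk, mk_image_coe_finset hinj] at this

lemma tr_range_lt_aleph0 {M : Subfield K} {ι : Type*} [Finite ι] (x : ι → K) :
    tr (Set.range x) M < ℵ₀ := by
  rw [tr_eq_cRk]
  exact (Matroid.cRk_le_cardinalMk _ _).trans_lt (Set.finite_range x).lt_aleph0

lemma exists_algebraicIndepOn (M : Subfield K) {ι : Type*} [Finite ι] (x : ι → K) :
    ∃ T : Finset ι, AlgebraicIndepOn M x (T : Set ι) ∧ (T.card : Cardinal) = tr (Set.range x) M ∧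
      ∀ i, x i ∈ acl ((M : Set K) ∪ x '' T) := by
  classical
  obtain ⟨B, hB⟩ := (matroid M K).exists_isBasis (Set.range x)
  obtain ⟨T, -, hT⟩ := Set.SurjOn.exists_bijOn_subset (f := x) (s := Set.univ) (t := B)
    (by rw [Set.SurjOn, Set.image_univ]; exact hB.subset)
  obtain ⟨T, rfl⟩ := T.toFinite.exists_finset_coe
  refine ⟨T, ?_, ?_, fun i => ?_⟩
  · refine (algebraicIndependent_image (R := M) hT.injOn).2 ?_
    rw [hT.image_eq]; exact hB.indep
  · rw [tr_eq_cRk, ← hB.cardinalMk_eq_cRk, ← hT.image_eq, mk_image_coe_finset hT.injOn]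
  · rw [hT.image_eq, ← SetLike.mem_coe, coe_acl_union, hB.closure_eq_closure]
    exact (matroid M K).subset_closure (Set.range x) (Set.subset_univ _) (Set.mem_range_self i)

/-! ### Isomorphisms of relative algebraic closures -/

open MvPolynomial

/-- An injective homomorphism into an algebraically closed field extends to every field algebraic
over its domain. -/
lemma exists_ringHom_comp_eq {R A B : Type*} [CommRing R] [IsDomain R] [Field A] [Field B]
    [IsAlgClosed B] (i : R →+* A) (φ : R →+* B) (hi : Function.Injective i)
    (hφ : Function.Injective φ) (h : ∀ a, @IsAlgebraic R A _ _ i.toAlgebra a) :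
    ∃ g : A →+* B, ∀ r, g (i r) = φ r := by
  let := i.toAlgebra
  let := φ.toAlgebra
  have : FaithfulSMul R A := (faithfulSMul_iff_algebraMap_injective R A).2 hi
  have : FaithfulSMul R B := (faithfulSMul_iff_algebraMap_injective R B).2 hφ
  have : Module.IsTorsionFree R A := inferInstance
  have : Module.IsTorsionFree R B := inferInstance
  have : Algebra.IsAlgebraic R A := ⟨h⟩
  exact ⟨(IsAlgClosed.lift : A →ₐ[R] B).toRingHom,
    fun r => (IsAlgClosed.lift : A →ₐ[R] B).commutes r⟩

lemma aeval_mem_of_forall_mem {M N : Subfield K} (h : M ≤ N) {ι : Type*} {x : ι → K}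
    (hx : ∀ i, x i ∈ N) (P : MvPolynomial ι M) : aeval x P ∈ N := by
  induction P using MvPolynomial.induction_on with
  | C a => rw [aeval_C]; exact h a.2
  | add p q hp hq => rw [map_add]; exact add_mem hp hq
  | mul_X p i hp => rw [map_mul, aeval_X]; exact mul_mem hp (hx i)

/-- Two families satisfying the same polynomial equations, up to the coefficient embedding `f`,
have isomorphic algebraic closures. -/
lemma exists_ringEquiv_acl [IsAlgClosed K] (M : Subfield K) (f : M →+* K) {ι : Type*} (x y : ι → K)
    (h : ∀ P : MvPolynomial ι M, aeval x P = 0 ↔ eval₂ f y P = 0) :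
    ∃ e : acl ((M : Set K) ∪ Set.range x) ≃+* acl (Set.range f ∪ Set.range y),
      (∀ (m : M) (hm : (m : K) ∈ acl ((M : Set K) ∪ Set.range x)), (e ⟨m, hm⟩ : K) = f m) ∧
      ∀ (i : ι) (hi : x i ∈ acl ((M : Set K) ∪ Set.range x)), (e ⟨x i, hi⟩ : K) = y i := by
  set A := acl ((M : Set K) ∪ Set.range x) with hA
  let R := Algebra.adjoin M (Set.range x)
  have hR : ∀ r : R, ∃ P : MvPolynomial ι M, aeval x P = (r : K) := fun r => by
    have : (r : K) ∈ (aeval x : MvPolynomial ι M →ₐ[M] K).range :=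
      (Algebra.adjoin_range_eq_range_aeval M x).le r.2
    exact this
  choose Q hQ using hR
  have hφ : ∀ (P : MvPolynomial ι M) (r : R), aeval x P = (r : K) →
      eval₂ f y (Q r) = eval₂ f y P := by
    intro P r hP
    rw [← sub_eq_zero, ← eval₂_sub, ← h, map_sub, hQ, hP, sub_self]
  let φ : R →+* K :=
    { toFun := fun r => eval₂ f y (Q r)
      map_one' := by rw [hφ 1 1 (by simp)]; simp
      map_zero' := by rw [hφ 0 0 (by simp)]; simp
      map_add' := fun r s => by rw [hφ (Q r + Q s) _ (by simp [hQ]), eval₂_add]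
      map_mul' := fun r s => by rw [hφ (Q r * Q s) _ (by simp [hQ]), eval₂_mul] }
  have hφP : ∀ (P : MvPolynomial ι M) (r : R), aeval x P = (r : K) → φ r = eval₂ f y P := hφ
  have hφinj : Function.Injective φ := by
    rw [injective_iff_map_eq_zero]
    intro r hr
    have : aeval x (Q r) = 0 := (h _).2 hr
    rw [hQ] at this
    exact Subtype.ext this
  have hRA : ∀ r : R, (r : K) ∈ A := fun r => by
    rw [hA, mem_acl_union_iff]
    exact isAlgebraic_algebraMap r
  let incl : R →+* A := R.val.toRingHom.codRestrict A hRA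
  obtain ⟨g, hg⟩ := exists_ringHom_comp_eq incl φ
    (fun r s hrs => Subtype.ext (congrArg (Subtype.val : A → K) hrs)) hφinj (fun a => by
      let := incl.toAlgebra
      have ha := (mem_acl_union_iff M (Set.range x)).1 a.2
      exact ha.of_ringHom_of_comp_eq (RingHom.id R) A.subtype Function.surjective_id
        Subtype.val_injective rfl)
  have hgM : ∀ (m : M) (hm : (m : K) ∈ A), g ⟨m, hm⟩ = f m := fun m hm => by
    have h1 := hg (algebraMap M R m)
    rw [hφP (C m) _ (by simp), eval₂_C] at h1
    exact h1
  have hgx : ∀ (i : ι) (hi : x i ∈ A), g ⟨x i, hi⟩ = y i := fun i hi => by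
    have h1 := hg ⟨x i, Algebra.subset_adjoin ⟨i, rfl⟩⟩
    rw [hφP (X i) _ (by simp), eval₂_X] at h1
    exact h1
  have hMA : ∀ m : M, (m : K) ∈ A := fun m => subset_acl _ (Or.inl m.2)
  have hxA : ∀ i, x i ∈ A := fun i => subset_acl _ (Or.inr ⟨i, rfl⟩)
  have hgA : ∀ a, g a ∈ acl (Set.range f ∪ Set.range y) := fun a => by
    have h1 : a ∈ acl ((↑) ⁻¹' ((M : Set K) ∪ Set.range x) : Set A) := by
      rw [← mem_acl_map_iff A.subtype]
      have h2 : A.subtype '' ((↑) ⁻¹' ((M : Set K) ∪ Set.range x)) = (M : Set K) ∪ Set.range x :=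
        (Subtype.image_preimage_coe (A : Set K) _).trans (Set.inter_eq_right.2 (subset_acl _))
      rw [h2]
      exact a.2
    rw [← mem_acl_map_iff g] at h1
    refine acl_mono ?_ h1
    rintro _ ⟨b, hb | ⟨i, hi⟩, rfl⟩
    · exact Or.inl ⟨⟨b, hb⟩, (hgM ⟨b, hb⟩ b.2).symm⟩
    · refine Or.inr ⟨i, ?_⟩
      rw [← hgx i (hxA i)]
      congr 1
      exact Subtype.ext hi
  have : IsAlgClosed A := isAlgClosed_of_acl_eq_self (acl_acl _)
  have : IsAlgClosed g.fieldRange := IsAlgClosed.of_ringEquiv _ _ g.rangeRestrictFieldEquiv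
  have hgsurj : ∀ z ∈ acl (Set.range f ∪ Set.range y), ∃ a, g a = z := fun z hz => by
    have h1 : z ∈ acl (g.fieldRange : Set K) := by
      refine acl_mono ?_ hz
      rintro _ (⟨m, rfl⟩ | ⟨i, rfl⟩)
      · exact ⟨⟨m, hMA m⟩, hgM _ _⟩
      · exact ⟨⟨x i, hxA i⟩, hgx _ _⟩
    rw [acl_eq_self_of_isAlgClosed] at h1
    exact h1
  refine ⟨RingEquiv.ofBijective (g.codRestrict _ hgA) ⟨RingHom.injective _, fun z => ?_⟩,
    hgM, hgx⟩
  obtain ⟨a, ha⟩ := hgsurj z z.2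
  exact ⟨a, Subtype.ext ha⟩

/-- If `y` is a specialisation of `x` over `M` and a transcendence basis of `x` stays independent
in `y`, then the specialisation is generic: every equation of `y` holds for `x`. Otherwise the
minimal equation of a non-vanishing value `P(x)` would specialise to a relation among the
`y i`, `i ∈ T`. -/
lemma aeval_eq_zero_of_algebraicIndepOn {M : Subfield K} {ι : Type*} {x y : ι → K}
    (hxy : ∀ P : MvPolynomial ι M, aeval x P = 0 → aeval y P = 0) {T : Set ι}
    (hT : AlgebraicIndepOn M y T) (hx : ∀ i, x i ∈ acl ((M : Set K) ∪ x '' T))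
    {P : MvPolynomial ι M} (hP : aeval y P = 0) : aeval x P = 0 := by
  by_contra hz
  have hmem : aeval x P ∈ acl ((M : Set K) ∪ x '' T) :=
    aeval_mem_of_forall_mem (fun m hm => subset_acl _ (Or.inl hm)) hx P
  rw [mem_acl_union_iff] at hmem
  obtain ⟨q, hq0, hq⟩ := hmem.exists_nonzero_coeff_and_aeval_eq_zero
    (mem_nonZeroDivisors_of_ne_zero hz)
  have hR : ∀ r : Algebra.adjoin M (x '' T), ∃ Q : MvPolynomial T M,
      aeval (fun i : T => x i) Q = (r : K) := fun r => by
    have : (r : K) ∈ (aeval (fun i : T => x i) : MvPolynomial T M →ₐ[M] K).range := by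
      rw [← Algebra.adjoin_range_eq_range_aeval, ← Set.image_eq_range]
      exact r.2
    exact this
  choose Q hQ using hR
  have hQr : ∀ (w : ι → K) (Q : MvPolynomial T M),
      aeval w (rename Subtype.val Q) = aeval (fun i : T => w i) Q := fun w Q => by
    rw [aeval_rename]; rfl
  have h1 : aeval x (∑ m ∈ Finset.range (q.natDegree + 1),
      rename Subtype.val (Q (q.coeff m)) * P ^ m) = 0 := by
    rw [map_sum, ← hq, Polynomial.aeval_eq_sum_range]
    refine Finset.sum_congr rfl fun m _ => ?_
    rw [map_mul, map_pow, hQr, hQ, Algebra.smul_def]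
    rfl
  have h2 := hxy _ h1
  rw [map_sum, Finset.sum_eq_single 0] at h2
  · rw [map_mul, pow_zero, map_one, mul_one, hQr] at h2
    have h3 := hT.eq_zero_of_aeval_eq_zero _ h2
    apply hq0
    have := hQ (q.coeff 0)
    rw [h3, map_zero] at this
    exact Subtype.ext this.symm
  · intro m _ hm
    rw [map_mul, map_pow, hP, zero_pow hm, mul_zero]
  · simp

/-! ### The `λ`-functions -/

lemma lambda_le (E : Subfield K) (A : Set K) : lambda E A ≤ E := by
  rw [lambda, Subfield.closure_le]
  rintro _ ⟨n, i, a₀, a, -, -, rfl⟩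
  unfold lambdaFun
  split_ifs with h
  · exact (h.1.repr ⟨a₀, h.2⟩ i).2
  · exact zero_mem E

lemma lambda_mono (E : Subfield K) {A B : Set K} (h : A ⊆ B) : lambda E A ≤ lambda E B := by
  refine Subfield.closure_mono ?_
  rintro _ ⟨n, i, a₀, a, h₀, ha, rfl⟩
  exact ⟨n, i, a₀, a, h h₀, fun j => h (ha j), rfl⟩

lemma lambda_eq_inf {E k : Subfield K} (hk : IsLambdaClosed E k) :
    lambda E (k : Set K) = k ⊓ E := by
  refine le_antisymm (le_inf hk (lambda_le _ _)) fun x hx => ?_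
  refine Subfield.subset_closure ⟨1, 0, x, fun _ => 1, hx.1, fun _ => one_mem k, ?_⟩
  have h1 : LinearIndependent E (fun _ : Fin 1 => (1 : K)) :=
    LinearIndependent.of_subsingleton 0 one_ne_zero
  have h2 : x ∈ Submodule.span E (Set.range (fun _ : Fin 1 => (1 : K))) := by
    rw [Set.range_const, Submodule.mem_span_singleton]
    exact ⟨⟨x, hx.2⟩, by simp [Subfield.smul_def]⟩
  rw [lambdaFun, dif_pos ⟨h1, h2⟩]
  have h3 := h1.linearCombination_repr ⟨x, h2⟩
  rw [Finsupp.linearCombination_unique] at h3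
  simpa [Subfield.smul_def] using h3.symm

/-- An `E`-linear dependence between elements of `A` is witnessed over `λ(A)`. -/
lemma exists_lambda_relation {E : Subfield K} {A : Set K} {ι : Type*} [Fintype ι] {u : ι → K}
    (hu : ∀ i, u i ∈ A) (h : ¬ LinearIndependent E u) :
    ∃ c : ι → K, (∀ i, c i ∈ lambda E A) ∧ (∃ i, c i ≠ 0) ∧ ∑ i, c i * u i = 0 := by
  classical
  obtain ⟨κ, a, ha, hspan, hind⟩ := exists_linearIndependent' E u
  have : Finite κ := Finite.of_injective a ha
  obtain ⟨m, ⟨e⟩⟩ := Finite.exists_equiv_fin κ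
  have hsurj : ∃ i₀, i₀ ∉ Set.range a := by
    by_contra! hs
    apply h
    let e' := Equiv.ofBijective a ⟨ha, hs⟩
    have := hind.comp e'.symm e'.symm.injective
    have hu : u = (u ∘ a) ∘ e'.symm := funext fun i => congrArg u (e'.apply_symm_apply i).symm
    rw [hu]
    exact this
  obtain ⟨i₀, hi₀⟩ := hsurj
  let w : Fin m → K := fun j => u (a (e.symm j))
  have hw : LinearIndependent E w := hind.comp e.symm e.symm.injective
  have hmem : u i₀ ∈ Submodule.span E (Set.range w) := by
    have : Set.range w = Set.range (u ∘ a) := e.symm.surjective.range_comp (u ∘ a)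
    rw [this, hspan]
    exact Submodule.subset_span ⟨i₀, rfl⟩
  let l : Fin m → K := fun j => lambdaFun E j (u i₀) w
  have hl : ∀ j, l j = hw.repr ⟨u i₀, hmem⟩ j := fun j => by
    simp only [l, lambdaFun]
    rw [dif_pos ⟨hw, hmem⟩]
  have hsum : ∑ j, l j * w j = u i₀ := by
    have h3 := hw.linearCombination_repr ⟨u i₀, hmem⟩
    rw [Finsupp.linearCombination_apply, Finsupp.sum_fintype _ _ (by simp)] at h3
    simpa only [hl, Subfield.smul_def, smul_eq_mul] using h3
  have hlmem : ∀ j, l j ∈ lambda E A := fun j =>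
    Subfield.subset_closure ⟨m, j, u i₀, w, hu _, fun _ => hu _, rfl⟩
  refine ⟨∑ j, Pi.single (a (e.symm j)) (l j) - Pi.single i₀ 1, fun i => ?_, ⟨i₀, ?_⟩, ?_⟩
  · rw [Pi.sub_apply, Finset.sum_apply]
    refine sub_mem (sum_mem fun j _ => ?_) ?_
    · rw [Pi.single_apply]; split_ifs; exacts [hlmem j, zero_mem _]
    · rw [Pi.single_apply]; split_ifs; exacts [one_mem _, zero_mem _]
  · rw [Pi.sub_apply, Finset.sum_apply, Finset.sum_eq_zero fun j _ => ?_]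
    · simp
    · exact Pi.single_eq_of_ne (fun h => hi₀ ⟨_, h.symm⟩) _
  · simp only [Pi.sub_apply, Finset.sum_apply, sub_mul, Finset.sum_sub_distrib, Finset.sum_mul]
    rw [Finset.sum_comm]
    simp only [Pi.single_apply, ite_mul, zero_mul, Finset.sum_ite_eq', Finset.mem_univ, if_true,
      one_mul]
    rw [sub_eq_zero]
    exact hsum

/-- `k` is linearly disjoint from `E` over `λ(k)`. -/
lemma linearIndependent_of_lambda {E k : Subfield K} {ι : Type*}
    {g : ι → K} (hg : ∀ i, g i ∈ k) (h : LinearIndependent (lambda E (k : Set K)) g) :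
    LinearIndependent E g := by
  rw [linearIndependent_iff_finset_linearIndependent] at h ⊢
  intro s
  by_contra hs
  obtain ⟨c, hc, ⟨i, hi⟩, hsum⟩ := exists_lambda_relation (A := (k : Set K)) (fun j : s => hg j) hs
  have := Fintype.linearIndependent_iff.1 (h s) (fun j => ⟨c j, hc j⟩)
    (by simpa [Subfield.smul_def] using hsum) i
  exact hi (congrArg Subtype.val this)

/-- A `λ`-closed field `k` is algebraically independent from `E` over `λ(k)`: by linear
disjointness, monomials in elements of `E` that are linearly independent over `λ(k)` remain so over
`k`. -/
lemma algebraicIndepOn_of_lambda {E k : Subfield K} (hk : IsLambdaClosed E k) {ι : Type*}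
    {x : ι → K} (hx : ∀ i, x i ∈ E) {T : Set ι}
    (hT : AlgebraicIndepOn (lambda E (k : Set K)) x T) : AlgebraicIndepOn k x T := by
  let F := lambda E (k : Set K)
  let k' : IntermediateField F K := Subfield.extendScalars (F := F) (E := k) hk
  let E' : IntermediateField F K := Subfield.extendScalars (F := F) (E := E) (lambda_le E k)
  have hdisj : k'.LinearDisjoint E' := by
    refine IntermediateField.LinearDisjoint.of_basis_left (Module.Basis.ofVectorSpace F k') ?_
    have h1 := linearIndependent_of_lambda (E := E) (k := k)
      (g := k'.val ∘ (Module.Basis.ofVectorSpace F k'))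
      (fun i => (Module.Basis.ofVectorSpace F k' i).2)
      ((Module.Basis.ofVectorSpace F k').linearIndependent.map' k'.val.toLinearMap
        (LinearMap.ker_eq_bot.2 Subtype.val_injective))
    exact h1
  let b : (T →₀ ℕ) → E' := fun m => m.prod fun i r => (⟨x i, hx i⟩ : E') ^ r
  have hb : ∀ m, (b m : K) = m.prod fun i r => x i ^ r := fun m => by
    simp [b, Finsupp.prod]
  have hbF : LinearIndependent F b := by
    have h1 : LinearIndependent F (fun m => (aeval (fun i : T => x i)) (basisMonomials T F m)) :=
      (basisMonomials T F).linearIndependent.map' (aeval (fun i : T => x i)).toLinearMap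
        (LinearMap.ker_eq_bot.2 hT)
    refine LinearIndependent.of_comp E'.val.toLinearMap ?_
    have h2 : (E'.val.toLinearMap ∘ b) =
        fun m => (aeval (fun i : T => x i)) (basisMonomials T F m) := by
      ext m
      simp [aeval_monomial, hb]
    rw [h2]
    exact h1
  have hbk := hdisj.linearIndependent_right hbF
  rw [AlgebraicIndepOn, algebraicIndependent_iff]
  intro P hP
  have h2 : ∑ m ∈ P.support,
      (⟨((coeff m P : k) : K), (coeff m P : k).2⟩ : k') • (E'.val ∘ b) m = 0 := by
    rw [← hP, aeval_def, eval₂_eq]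
    refine Finset.sum_congr rfl fun m _ => ?_
    change ((coeff m P : k) : K) * (b m : K) = ((coeff m P : k) : K) * _
    rw [hb]
    rfl
  ext m
  by_cases hm : m ∈ P.support
  · have := linearIndependent_iff'.1 hbk _ _ h2 m hm
    exact congrArg (Subtype.val : k' → K) this
  · rw [notMem_support_iff.1 hm, coeff_zero]

/-! ### Free subfields -/

/-- `L` and `E` are algebraically independent over `L ∩ E`: an element of `E` that is algebraic
over `L` together with some `S ⊆ E` is already algebraic over `L ∩ E` together with `S`. -/
def IsFree (E L : Subfield K) : Prop :=
  ∀ S : Set K, S ⊆ E → ∀ e ∈ E, e ∈ acl ((L : Set K) ∪ S) →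
    e ∈ acl (((L ⊓ E : Subfield K) : Set K) ∪ S)

lemma IsLambdaClosed.isFree {E k : Subfield K} (hk : IsLambdaClosed E k) : IsFree E k := by
  intro S hS e he hek
  rw [← lambda_eq_inf hk]
  by_contra hcon
  set F := lambda E (k : Set K) with hF
  obtain ⟨B, hB⟩ := (matroid F K).exists_isBasis S
  have hSB : S ⊆ acl ((F : Set K) ∪ B) := by
    rw [coe_acl_union, hB.closure_eq_closure]
    exact (matroid F K).subset_closure S (Set.subset_univ _)
  have hacl : e ∉ acl ((F : Set K) ∪ B) := fun h =>
    hcon (acl_mono (Set.union_subset_union_right _ hB.subset) h)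
  let x : ↥(insert e B : Set K) → K := Subtype.val
  have hxE : ∀ i, x i ∈ E := by
    rintro ⟨i, rfl | hi⟩
    · exact he
    · exact hS (hB.subset hi)
  let i₀ : ↥(insert e B : Set K) := ⟨e, Or.inl rfl⟩
  have himg : x '' {i₀}ᶜ = B := by
    ext z
    constructor
    · rintro ⟨⟨w, hw⟩, hw', rfl⟩
      exact hw.resolve_left fun h => hw' (Subtype.ext h)
    · intro hz
      refine ⟨⟨z, Or.inr hz⟩, fun h => hacl ?_, rfl⟩
      have : z = e := congrArg Subtype.val h
      exact this ▸ subset_acl _ (Or.inr hz)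
  have hind : AlgebraicIndepOn F x {i₀}ᶜ := by
    refine (algebraicIndependent_image (R := F) Subtype.val_injective.injOn).2 ?_
    change AlgebraicIndependent F fun y : ↥(x '' {i₀}ᶜ) => (y : K)
    rw [himg]
    exact hB.indep
  have hins := (algebraicIndepOn_insert_iff F (x := x) (T := {i₀}ᶜ) (i := i₀) (by simp)).2
    ⟨hind, by rw [himg]; exact hacl⟩
  have := (algebraicIndepOn_insert_iff k (x := x) (T := {i₀}ᶜ) (i := i₀) (by simp)).1
    (algebraicIndepOn_of_lambda hk hxE hins)
  rw [himg] at this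
  refine this.2 (acl_le ?_ hek)
  have hFk : acl ((F : Set K) ∪ B) ≤ acl ((k : Set K) ∪ B) :=
    acl_mono (Set.union_subset_union_left _ hk)
  exact Set.union_subset (Set.subset_union_left.trans (subset_acl _)) (hSB.trans hFk)

lemma acl_coe_union (A B : Set K) : acl ((acl A : Set K) ∪ B) = acl (A ∪ B) :=
  le_antisymm (acl_union_le (acl_mono Set.subset_union_left)
      (Set.subset_union_right.trans (subset_acl _)))
    (acl_mono (Set.union_subset_union_left _ (subset_acl _)))

lemma acl_inf_union_le (L E : Subfield K) (S : Set K) (hS : S ⊆ E) [IsAlgClosed E] :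
    acl (((L ⊓ E : Subfield K) : Set K) ∪ S) ≤ E := by
  conv_rhs => rw [← acl_eq_self_of_isAlgClosed E]
  exact acl_mono (Set.union_subset (fun x hx => hx.2) hS)

lemma IsFree.inf_acl_union {E L : Subfield K} [IsAlgClosed E] (h : IsFree E L) {S : Set K}
    (hS : S ⊆ E) : acl ((L : Set K) ∪ S) ⊓ E = acl (((L ⊓ E : Subfield K) : Set K) ∪ S) :=
  le_antisymm (fun e he => h S hS e he.2 he.1)
    (le_inf (acl_mono (Set.union_subset_union_left _ fun _ hx => hx.1))
      (acl_inf_union_le L E S hS))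

lemma IsFree.acl_union {E L : Subfield K} [IsAlgClosed E] (h : IsFree E L) {S : Set K}
    (hS : S ⊆ E) : IsFree E (acl ((L : Set K) ∪ S)) := by
  intro S' hS' e he hes
  rw [h.inf_acl_union hS, acl_coe_union, Set.union_assoc]
  rw [acl_coe_union, Set.union_assoc] at hes
  exact h _ (Set.union_subset hS hS') e he hes

/-- Adjoining an element transcendental over `E · L` keeps `L` free and adds nothing to
`acl(L ∩ E)`. -/
lemma IsFree.acl_insert {E L : Subfield K} (h : IsFree E L) {x : K}
    (hx : x ∉ acl ((L : Set K) ∪ E)) :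
    (acl (insert x (L : Set K)) ⊓ E ≤ acl ((L ⊓ E : Subfield K) : Set K)) ∧
    IsFree E (acl (insert x (L : Set K))) := by
  have key : ∀ S : Set K, S ⊆ E → ∀ e ∈ E, e ∈ acl (insert x (L : Set K) ∪ S) →
      e ∈ acl (((L ⊓ E : Subfield K) : Set K) ∪ S) := by
    intro S hS e he hes
    by_contra hcon
    have h1 : e ∉ acl ((L : Set K) ∪ S) := fun h' => hcon (h S hS e he h')
    rw [Set.insert_union] at hes
    refine hx (acl_le ?_ (acl_exchange hes h1))
    refine Set.Subset.trans ?_ (subset_acl _)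
    rintro z (rfl | hz | hz)
    · exact Or.inr he
    · exact Or.inl hz
    · exact Or.inr (hS hz)
  refine ⟨fun e he => ?_, fun S hS e he hes => ?_⟩
  · simpa using key ∅ (Set.empty_subset _) e he.2 (by simpa using he.1)
  · rw [acl_coe_union] at hes
    refine acl_mono ?_ (key S hS e he hes)
    refine Set.union_subset_union_left _ fun z hz => ⟨subset_acl _ (Or.inr hz.1), hz.2⟩

lemma IsFree.acl_union_image {E L : Subfield K} [IsAlgClosed E] (h : IsFree E L)
    {ι : Type*} {x : ι → K}
    (hL : acl (L : Set K) = L) {T : Finset ι} {k : Subfield K}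
    (hT : AlgebraicIndepOn (E ⊔ k : Subfield K) x (T : Set ι))
    (hk : (L : Set K) ⊆ acl ((E : Set K) ∪ k)) :
    acl ((L : Set K) ∪ x '' T) ⊓ E ≤ L ⊓ E ∧ IsFree E (acl ((L : Set K) ∪ x '' T)) := by
  classical
  induction T using Finset.induction_on with
  | empty => simp [hL, h]
  | insert i T hi ih =>
    rw [Finset.coe_insert] at hT ⊢
    rw [algebraicIndepOn_insert_iff _ (by simpa using hi)] at hT
    obtain ⟨ih1, ih2⟩ := ih hT.1
    have hx : x i ∉ acl ((acl ((L : Set K) ∪ x '' T) : Set K) ∪ E) := by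
      intro hmem
      refine hT.2 (acl_le ?_ hmem)
      have hEk : acl ((E : Set K) ∪ k) ≤ acl (((E ⊔ k : Subfield K) : Set K) ∪ x '' T) :=
        acl_mono ((Set.union_subset (SetLike.coe_subset_coe.2 le_sup_left)
          (SetLike.coe_subset_coe.2 le_sup_right)).trans Set.subset_union_left)
      refine Set.union_subset ?_ (Set.Subset.trans (Set.subset_union_left.trans (subset_acl _)) hEk)
      exact acl_union_le (hk.trans hEk) (Set.subset_union_right.trans (subset_acl _))
    obtain ⟨h1, h2⟩ := ih2.acl_insert hx
    have heq : acl (insert (x i) (acl ((L : Set K) ∪ x '' T) : Set K)) =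
        acl ((L : Set K) ∪ x '' insert i (T : Set ι)) := by
      rw [Set.insert_eq, Set.union_comm, acl_coe_union, Set.image_insert_eq, Set.union_assoc,
        Set.union_singleton]
    rw [heq] at h1 h2
    refine ⟨h1.trans ?_, h2⟩
    refine (acl_mono (SetLike.coe_subset_coe.2 ih1)).trans ?_
    exact le_inf ((acl_mono fun _ hz => hz.1).trans hL.le)
      ((acl_mono fun _ hz => hz.2).trans (acl_eq_self_of_isAlgClosed E).le)

/-! ### Admissible isomorphisms and back-and-forth -/

/-- The isomorphisms of the back-and-forth system: isomorphisms over `k`, respecting `E`, between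
relatively algebraically closed free subfields with fewer than `κ` elements that contain `k`. That
the image contains `k` and is small follows, see `IsAdmissible.symm`. -/
structure IsAdmissible (E : Subfield K) (κ : Cardinal.{u}) (k : Subfield K) {L L' : Subfield K}
    (f : L ≃+* L') : Prop where
  acl_left : acl (L : Set K) = L
  acl_right : acl (L' : Set K) = L'
  free_left : IsFree E L
  free_right : IsFree E L'
  mem_iff : ∀ x : L, (x : K) ∈ E ↔ (f x : K) ∈ E
  card_lt : #L < κ
  le_left : k ≤ L
  apply_eq : ∀ (x : L), (x : K) ∈ k → (f x : K) = x

/-- The isomorphism `f₁` extends `f`. -/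
def Extends {L L' L₁ L₁' : Subfield K} (f₁ : L₁ ≃+* L₁') (f : L ≃+* L') : Prop :=
  ∃ h : L ≤ L₁, ∀ x : L, (f₁ ⟨x, h x.2⟩ : K) = f x

lemma Extends.refl {L L' : Subfield K} (f : L ≃+* L') : Extends f f := ⟨le_rfl, fun _ => rfl⟩

lemma Extends.trans {L L' L₁ L₁' L₂ L₂' : Subfield K} {f₂ : L₂ ≃+* L₂'} {f₁ : L₁ ≃+* L₁'}
    {f : L ≃+* L'} (h₂ : Extends f₂ f₁) (h₁ : Extends f₁ f) : Extends f₂ f := by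
  obtain ⟨h, hf⟩ := h₁
  obtain ⟨h', hf'⟩ := h₂
  exact ⟨h.trans h', fun x => (hf' ⟨x, h x.2⟩).trans (hf x)⟩

lemma IsAdmissible.symm {E k : Subfield K} {κ : Cardinal.{u}} {L L' : Subfield K} {f : L ≃+* L'}
    (hf : IsAdmissible E κ k f) : IsAdmissible E κ k f.symm where
  acl_left := hf.acl_right
  acl_right := hf.acl_left
  free_left := hf.free_right
  free_right := hf.free_left
  mem_iff x := by rw [hf.mem_iff, f.apply_symm_apply]
  card_lt := (mk_congr f.symm.toEquiv).trans_lt hf.card_lt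
  le_left x hx := by
    have h : (f ⟨x, hf.le_left hx⟩ : K) = x := hf.apply_eq ⟨x, hf.le_left hx⟩ hx
    exact h ▸ (f ⟨x, hf.le_left hx⟩).2
  apply_eq x hx := by
    have h := hf.apply_eq ⟨x, hf.le_left hx⟩ hx
    have : f ⟨x, hf.le_left hx⟩ = x := Subtype.ext h
    rw [← this, f.symm_apply_apply, h]

lemma Extends.symm {L L' L₁ L₁' : Subfield K} {f₁ : L₁ ≃+* L₁'} {f : L ≃+* L'}
    (h : Extends f₁ f) : Extends f₁.symm f.symm := by
  obtain ⟨h, hf⟩ := h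
  have key : ∀ y : L', (f₁ ⟨f.symm y, h (f.symm y).2⟩ : K) = y := fun y => by
    rw [hf, f.apply_symm_apply]
  have hle : L' ≤ L₁' := fun y hy => by
    have h1 : (f₁ ⟨f.symm ⟨y, hy⟩, h (f.symm ⟨y, hy⟩).2⟩ : K) = y := key ⟨y, hy⟩
    exact h1 ▸ (f₁ ⟨f.symm ⟨y, hy⟩, h (f.symm ⟨y, hy⟩).2⟩).2
  refine ⟨hle, fun y => ?_⟩
  have : f₁.symm ⟨y, hle y.2⟩ = ⟨f.symm y, h (f.symm y).2⟩ := by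
    rw [RingEquiv.symm_apply_eq]; exact Subtype.ext (key y).symm
  exact congrArg Subtype.val this

lemma mem_acl_apply_iff {L L' : Subfield K} (f : L ≃+* L') (S : Set L) (x : L) :
    (f x : K) ∈ acl ((fun z : L => (f z : K)) '' S) ↔ (x : K) ∈ acl ((↑) '' S) :=
  (mem_acl_map_iff (L'.subtype.comp f.toRingHom) S x).trans (mem_acl_map_iff L.subtype S x).symm

lemma mk_acl_lt {κ : Cardinal.{u}} (hκ : ℵ₀ < κ) {S : Set K} (hS : #S < κ) : #(acl S) < κ :=
  (mk_acl_le S).trans_lt (max_lt hS hκ)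

/-- An isomorphism respects the algebraically closed field `E` as soon as it does so on sets over
which the traces of `E` on both sides are algebraic. -/
lemma mem_iff_apply_mem {E : Subfield K} [IsAlgClosed E] {A B : Subfield K} (e : A ≃+* B)
    {U V : Set K} (hU : ∀ u ∈ U, ∃ h : u ∈ A, u ∈ E ∧ (e ⟨u, h⟩ : K) ∈ E)
    (hV : ∀ v ∈ V, ∃ a : A, (e a : K) = v ∧ (a : K) ∈ E ∧ v ∈ E)
    (hA : ∀ z ∈ A, z ∈ E → z ∈ acl U) (hB : ∀ z ∈ B, z ∈ E → z ∈ acl V) (z : A) :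
    (z : K) ∈ E ↔ (e z : K) ∈ E := by
  let S : Set A := {s | (s : K) ∈ E ∧ (e s : K) ∈ E}
  have hE := acl_eq_self_of_isAlgClosed E
  constructor
  · intro hz
    rw [← hE]
    have h1 : (z : K) ∈ acl ((↑) '' S) := by
      refine acl_mono (fun u hu => ?_) (hA z z.2 hz)
      obtain ⟨h, h1, h2⟩ := hU u hu
      exact ⟨⟨u, h⟩, ⟨h1, h2⟩, rfl⟩
    rw [← mem_acl_apply_iff e] at h1
    refine acl_mono ?_ h1
    rintro _ ⟨s, hs, rfl⟩
    exact hs.2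
  · intro hz
    rw [← hE]
    have h1 : (e z : K) ∈ acl ((fun w : A => (e w : K)) '' S) := by
      refine acl_mono (fun v hv => ?_) (hB _ (e z).2 hz)
      obtain ⟨a, rfl, h1, h2⟩ := hV v hv
      exact ⟨a, ⟨h1, h2⟩, rfl⟩
    rw [mem_acl_apply_iff e] at h1
    refine acl_mono ?_ h1
    rintro _ ⟨s, hs, rfl⟩
    exact hs.1

/-- One-point extension: `x` can be sent to any `y` such that both lie in `E` and outside the
fields, or both are transcendental over the composita with `E`. -/
lemma IsAdmissible.exists_extends [IsAlgClosed K] {E k : Subfield K} [IsAlgClosed E]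
    {κ : Cardinal.{u}} (hκ : ℵ₀ < κ) {L L' : Subfield K} {f : L ≃+* L'}
    (hf : IsAdmissible E κ k f) {x y : K} (hx : x ∉ L) (hy : y ∉ L')
    (hxy : (x ∈ E ∧ y ∈ E) ∨ (x ∉ acl ((L : Set K) ∪ E) ∧ y ∉ acl ((L' : Set K) ∪ E))) :
    ∃ (L₁ L₁' : Subfield K) (f₁ : L₁ ≃+* L₁'), IsAdmissible E κ k f₁ ∧ Extends f₁ f ∧
      ∃ h : x ∈ L₁, (f₁ ⟨x, h⟩ : K) = y := by
  have hx' : AlgebraicIndependent L (fun _ : Unit => x) := by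
    rw [algebraicIndependent_unique_type_iff]
    intro h
    apply hx
    rw [← hf.acl_left, mem_acl, Subfield.closure_eq]
    exact h
  have hy' : AlgebraicIndependent L' (fun _ : Unit => y) := by
    rw [algebraicIndependent_unique_type_iff]
    intro h
    apply hy
    rw [← hf.acl_right, mem_acl, Subfield.closure_eq]
    exact h
  let g : L →+* K := L'.subtype.comp f.toRingHom
  have hrange : Set.range g = L' := by
    ext z
    constructor
    · rintro ⟨w, rfl⟩; exact (f w).2
    · intro hz; exact ⟨f.symm ⟨z, hz⟩, congrArg Subtype.val (f.apply_symm_apply ⟨z, hz⟩)⟩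
  have hexist := exists_ringEquiv_acl L g (fun _ : Unit => x) (fun _ : Unit => y)
    (fun P => by
      have h1 : eval₂ g (fun _ : Unit => y) P = aeval (fun _ : Unit => y) (map f.toRingHom P) := by
        rw [aeval_def, eval₂_map]; rfl
      rw [h1]
      constructor
      · intro h; rw [hx'.eq_zero_of_aeval_eq_zero _ h, map_zero, map_zero]
      · intro h
        have h2 := hy'.eq_zero_of_aeval_eq_zero _ h
        rw [map_injective _ f.injective (h2.trans (map_zero _).symm), map_zero])
  rw [hrange, Set.range_const, Set.range_const] at hexist
  obtain ⟨e, he, hex⟩ := hexist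
  have hL₁ : L ≤ acl ((L : Set K) ∪ {x}) :=
    fun z hz => subset_acl _ (Or.inl hz)
  have hxL₁ : x ∈ acl ((L : Set K) ∪ {x}) := subset_acl _ (Or.inr rfl)
  have hext : Extends e f := ⟨hL₁, fun z => he z _⟩
  have hcard : #(acl ((L : Set K) ∪ {x})) < κ := by
    refine mk_acl_lt hκ ((mk_union_le _ _).trans_lt ?_)
    refine add_lt_of_lt hκ.le hf.card_lt ?_
    rw [mk_singleton]
    exact one_lt_aleph0.trans hκ
  have hfree : IsFree E (acl ((L : Set K) ∪ {x})) ∧ IsFree E (acl ((L' : Set K) ∪ {y})) := by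
    rcases hxy with ⟨h1, h2⟩ | ⟨h1, h2⟩
    · exact ⟨hf.free_left.acl_union (Set.singleton_subset_iff.2 h1),
        hf.free_right.acl_union (Set.singleton_subset_iff.2 h2)⟩
    · rw [Set.union_singleton, Set.union_singleton]
      exact ⟨(hf.free_left.acl_insert h1).2, (hf.free_right.acl_insert h2).2⟩
  have hmem : ∀ z : acl ((L : Set K) ∪ {x}), (z : K) ∈ E ↔ (e z : K) ∈ E := by
    have hU : ∀ u ∈ ((L ⊓ E : Subfield K) : Set K),
        ∃ h : u ∈ acl ((L : Set K) ∪ {x}), u ∈ E ∧ (e ⟨u, h⟩ : K) ∈ E := fun u hu => by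
      refine ⟨hL₁ hu.1, hu.2, ?_⟩
      rw [he ⟨u, hu.1⟩]
      exact (hf.mem_iff ⟨u, hu.1⟩).1 hu.2
    have hV : ∀ v ∈ ((L' ⊓ E : Subfield K) : Set K),
        ∃ a : acl ((L : Set K) ∪ {x}), (e a : K) = v ∧ (a : K) ∈ E ∧ v ∈ E := fun v hv => by
      have h1 : (f (f.symm ⟨v, hv.1⟩) : K) = v := by rw [f.apply_symm_apply]
      refine ⟨⟨f.symm ⟨v, hv.1⟩, hL₁ (f.symm _).2⟩, (he _ _).trans h1, ?_, hv.2⟩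
      exact (hf.mem_iff _).2 (h1.symm ▸ hv.2)
    rcases hxy with ⟨h1, h2⟩ | ⟨h1, h2⟩
    · refine mem_iff_apply_mem e (U := ((L ⊓ E : Subfield K) : Set K) ∪ {x})
        (V := ((L' ⊓ E : Subfield K) : Set K) ∪ {y}) ?_ ?_
        (fun z hz hzE => hf.free_left _ (Set.singleton_subset_iff.2 h1) z hzE hz)
        (fun z hz hzE => hf.free_right _ (Set.singleton_subset_iff.2 h2) z hzE hz)
      · rintro u (hu | rfl)
        · exact hU u hu
        · exact ⟨hxL₁, h1, by rw [hex ()]; exact h2⟩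
      · rintro v (hv | rfl)
        · exact hV v hv
        · exact ⟨⟨x, hxL₁⟩, hex () _, h1, h2⟩
    · refine mem_iff_apply_mem e hU hV (fun z hz hzE => ?_) (fun z hz hzE => ?_)
      · rw [Set.union_singleton] at hz
        exact (hf.free_left.acl_insert h1).1 ⟨hz, hzE⟩
      · rw [Set.union_singleton] at hz
        exact (hf.free_right.acl_insert h2).1 ⟨hz, hzE⟩
  exact ⟨_, _, e, ⟨acl_acl _, acl_acl _, hfree.1, hfree.2, hmem, hcard, hf.le_left.trans hL₁,
    fun z hz => (he ⟨z, hf.le_left hz⟩ z.2).trans (hf.apply_eq ⟨z, hf.le_left hz⟩ hz)⟩, hext,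
    hxL₁, hex () _⟩

/-- What back-and-forth needs from saturation: over each subfield with fewer than `κ` elements,
there are a new element of `E` and an element transcendental over the compositum with `E`. -/
structure IsRich (E : Subfield K) (κ : Cardinal.{u}) : Prop where
  aleph0_lt : ℵ₀ < κ
  exists_mem : ∀ L : Subfield K, #L < κ → ∃ e ∈ E, e ∉ L
  exists_notMem_acl : ∀ L : Subfield K, #L < κ → ∃ x, x ∉ acl ((L : Set K) ∪ E)

lemma IsAdmissible.exists_extends_of_mem [IsAlgClosed K] {E k : Subfield K} [IsAlgClosed E]
    {κ : Cardinal.{u}} (hE : IsRich E κ) {L L' : Subfield K} {f : L ≃+* L'}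
    (hf : IsAdmissible E κ k f) {x : K} (hx : x ∈ E) :
    ∃ (L₁ L₁' : Subfield K) (f₁ : L₁ ≃+* L₁'), IsAdmissible E κ k f₁ ∧ Extends f₁ f ∧ x ∈ L₁ := by
  by_cases hxL : x ∈ L
  · exact ⟨L, L', f, hf, .refl f, hxL⟩
  · obtain ⟨y, hy, hyL⟩ := hE.exists_mem L' hf.symm.card_lt
    obtain ⟨L₁, L₁', f₁, h1, h2, h3, -⟩ :=
      hf.exists_extends hE.aleph0_lt hxL hyL (Or.inl ⟨hx, hy⟩)
    exact ⟨L₁, L₁', f₁, h1, h2, h3⟩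

lemma IsAdmissible.exists_extends_of_finite [IsAlgClosed K] {E k : Subfield K} [IsAlgClosed E]
    {κ : Cardinal.{u}} (hE : IsRich E κ) {L L' : Subfield K} {f : L ≃+* L'}
    (hf : IsAdmissible E κ k f) {S : Set K} (hS : S.Finite) (hSE : S ⊆ E) :
    ∃ (L₁ L₁' : Subfield K) (f₁ : L₁ ≃+* L₁'),
      IsAdmissible E κ k f₁ ∧ Extends f₁ f ∧ S ⊆ L₁ := by
  induction S, hS using Set.Finite.induction_on with
  | empty => exact ⟨L, L', f, hf, .refl f, Set.empty_subset _⟩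
  | @insert a S _ _ ih =>
    obtain ⟨L₁, L₁', f₁, h1, h2, h3⟩ := ih fun z hz => hSE (Or.inr hz)
    obtain ⟨L₂, L₂', f₂, h4, h5, h6⟩ := h1.exists_extends_of_mem hE (hSE (Or.inl rfl))
    refine ⟨L₂, L₂', f₂, h4, h5.trans h2, ?_⟩
    rintro z (rfl | hz)
    · exact h6
    · exact h5.choose (h3 hz)

/-- The forth property. If `x` is algebraic over `L` and `E`, finitely many elements of `E` are
added to `L` first. -/
lemma IsAdmissible.forth [IsAlgClosed K] {E k : Subfield K} [IsAlgClosed E]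
    {κ : Cardinal.{u}} (hE : IsRich E κ) {L L' : Subfield K} {f : L ≃+* L'}
    (hf : IsAdmissible E κ k f) (x : K) :
    ∃ (L₁ L₁' : Subfield K) (f₁ : L₁ ≃+* L₁'), IsAdmissible E κ k f₁ ∧ Extends f₁ f ∧ x ∈ L₁ := by
  by_cases hx : x ∈ acl ((L : Set K) ∪ E)
  · obtain ⟨T, hT, hTf, hxT⟩ := exists_finite_of_mem_acl hx
    obtain ⟨L₁, L₁', f₁, h1, h2, h3⟩ := hf.exists_extends_of_finite hE (S := T ∩ E)
      (hTf.subset Set.inter_subset_left) Set.inter_subset_right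
    refine ⟨L₁, L₁', f₁, h1, h2, ?_⟩
    rw [← h1.acl_left]
    refine acl_mono (fun z hz => ?_) hxT
    rcases hT hz with h | h
    · exact h2.choose h
    · exact h3 ⟨hz, h⟩
  · obtain ⟨y, hy⟩ := hE.exists_notMem_acl L' hf.symm.card_lt
    obtain ⟨L₁, L₁', f₁, h1, h2, h3, -⟩ := hf.exists_extends hE.aleph0_lt
      (fun h => hx (subset_acl _ (Or.inl h))) (fun h => hy (subset_acl _ (Or.inl h)))
      (Or.inr ⟨hx, hy⟩)
    exact ⟨L₁, L₁', f₁, h1, h2, h3⟩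

lemma IsAdmissible.back [IsAlgClosed K] {E k : Subfield K} [IsAlgClosed E]
    {κ : Cardinal.{u}} (hE : IsRich E κ) {L L' : Subfield K} {f : L ≃+* L'}
    (hf : IsAdmissible E κ k f) (y : K) :
    ∃ (L₁ L₁' : Subfield K) (f₁ : L₁ ≃+* L₁'), IsAdmissible E κ k f₁ ∧ Extends f₁ f ∧ y ∈ L₁' := by
  obtain ⟨L₁, L₁', f₁, h1, h2, h3⟩ := hf.symm.forth hE y
  exact ⟨L₁', L₁, f₁.symm, h1.symm, h2.symm, h3⟩

/-- Small, relatively algebraically closed free subfields are `λ`-closed. -/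
lemma IsFree.isLambdaClosed [IsAlgClosed K] {E L : Subfield K} [IsAlgClosed E]
    {κ : Cardinal.{u}} (hE : IsRich E κ) (hL : IsFree E L) (hacl : acl (L : Set K) = L)
    (hcard : #L < κ) : IsLambdaClosed E L := by
  rw [IsLambdaClosed, lambda, Subfield.closure_le]
  rintro _ ⟨n, i, a₀, a, h₀, ha, rfl⟩
  unfold lambdaFun
  split_ifs with h
  swap
  · exact zero_mem L
  set c := h.1.repr ⟨a₀, h.2⟩ with hc
  have hsum : ∑ j, (c j : K) * a j = a₀ := by
    have h3 := h.1.linearCombination_repr ⟨a₀, h.2⟩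
    rw [Finsupp.linearCombination_apply, Finsupp.sum_fintype _ _ (by simp)] at h3
    simpa only [Subfield.smul_def, smul_eq_mul] using h3
  by_contra hcL
  have hid : IsAdmissible E κ L (RingEquiv.refl L) :=
    ⟨hacl, hacl, hL, hL, fun _ => Iff.rfl, hcard, le_rfl, fun _ _ => rfl⟩
  -- An admissible isomorphism over `L` moves the coefficient `c i` to `c i + 1`, but it must
  -- preserve the unique expression of `a₀`.
  have hcL' : (c i : K) + 1 ∉ L := fun h' => hcL (by simpa using sub_mem h' (one_mem L))
  obtain ⟨L₁, L₁', f₁, h1, h2, h3, h4⟩ := hid.exists_extends hE.aleph0_lt hcL hcL'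
    (Or.inl ⟨(c i).2, add_mem (c i).2 (one_mem E)⟩)
  obtain ⟨L₂, L₂', f₂, h5, h6, h7⟩ := h1.exists_extends_of_finite hE
    (Set.finite_range fun j => (c j : K)) (by rintro _ ⟨j, rfl⟩; exact (c j).2)
  have hc₂ : ∀ j, (c j : K) ∈ L₂ := fun j => h7 ⟨j, rfl⟩
  have ha₂ : ∀ z (hz : z ∈ L), (f₂ ⟨z, h5.le_left hz⟩ : K) = z := fun z hz => h5.apply_eq _ hz
  let c' : Fin n → E := fun j => ⟨f₂ ⟨c j, hc₂ j⟩, (h5.mem_iff _).1 (c j).2⟩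
  have hsum' : ∑ j, (c' j : K) * a j = a₀ := by
    have h8 : ∑ j, (⟨c j, hc₂ j⟩ : L₂) * ⟨a j, h5.le_left (ha j)⟩ = ⟨a₀, h5.le_left h₀⟩ := by
      apply Subtype.ext
      push_cast
      simpa using hsum
    have h9 := congrArg (fun z => (f₂ z : K)) h8
    simp only [map_sum, map_mul] at h9
    rw [ha₂ _ h₀] at h9
    rw [← h9]
    push_cast
    exact Finset.sum_congr rfl fun j _ => by rw [ha₂ _ (ha j)]
  have heq : ∑ j, (c' j - c j) • a j = 0 := by
    simp only [Subfield.smul_def, smul_eq_mul, AddSubgroupClass.coe_sub, sub_mul,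
      Finset.sum_sub_distrib, hsum, hsum', sub_self]
  have h10 := Fintype.linearIndependent_iff.1 h.1 _ heq i
  have h11 : (f₂ ⟨c i, hc₂ i⟩ : K) = (c i : K) := by
    have := congrArg (Subtype.val : E → K) (sub_eq_zero.1 h10)
    exact this
  have h12 : (f₂ ⟨c i, hc₂ i⟩ : K) = c i + 1 := by
    obtain ⟨hle, hx⟩ := h6
    rw [← h4]
    exact hx ⟨c i, h3⟩
  rw [h12] at h11
  simp at h11

/-! ### Admissible isomorphisms are elementary -/

/-- Admissible isomorphisms commute with the terms over `k`. -/
lemma IsAdmissible.exists_realize_eq {E k : Subfield K} {κ : Cardinal.{u}} {L L' : Subfield K}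
    {f : L ≃+* L'} (hf : IsAdmissible E κ k f) {α : Type*}
    (t : pairLang[[(k : Set K)]].Term α) (v : α → L) :
    letI := pairStructure E
    ∃ z : L, t.realize (fun i => (v i : K)) = z ∧ t.realize (fun i => (f (v i) : K)) = f z := by
  let := pairStructure E
  induction t with
  | var i => exact ⟨v i, rfl, rfl⟩
  | func g ts ih =>
    choose z hz hz' using ih
    simp only [Term.realize, hz, hz']
    rcases g with (g | g) | g
    · cases g with
      | add => exact ⟨z 0 + z 1, rfl, by rw [map_add]; rfl⟩
      | mul => exact ⟨z 0 * z 1, rfl, by rw [map_mul]; rfl⟩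
      | neg => exact ⟨- z 0, rfl, by rw [map_neg]; rfl⟩
      | zero => exact ⟨0, rfl, by rw [map_zero]; rfl⟩
      | one => exact ⟨1, rfl, by rw [map_one]; rfl⟩
    · exact g.elim
    · rename_i n
      cases n with
      | zero =>
        refine ⟨⟨(g : (k : Set K)), hf.le_left (g : (k : Set K)).2⟩, rfl, ?_⟩
        exact (hf.apply_eq ⟨(g : (k : Set K)), hf.le_left (g : (k : Set K)).2⟩
          (g : (k : Set K)).2).symm
      | succ n => exact g.elim

/-- Admissible isomorphisms are elementary, by induction on formulas with back-and-forth at the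
quantifier. -/
lemma IsAdmissible.realize_iff [IsAlgClosed K] {E k : Subfield K} [IsAlgClosed E]
    {κ : Cardinal.{u}} (hE : IsRich E κ) {α : Type*} {n : ℕ}
    (φ : pairLang[[(k : Set K)]].BoundedFormula α n) :
    letI := pairStructure E
    ∀ {L L' : Subfield K} {f : L ≃+* L'}, IsAdmissible E κ k f → ∀ (v : α → L) (w : Fin n → L),
    φ.Realize (fun i => (v i : K)) (fun i => (w i : K)) ↔
      φ.Realize (fun i => (f (v i) : K)) (fun i => (f (w i) : K)) := by
  let := pairStructure E
  have helim : ∀ {n : ℕ} {L L' : Subfield K} (f : L ≃+* L') (v : α → L) (w : Fin n → L),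
      (Sum.elim (fun i => (v i : K)) (fun i => (w i : K)) = fun i => ((Sum.elim v w i : L) : K)) ∧
      (Sum.elim (fun i => (f (v i) : K)) (fun i => (f (w i) : K)) =
        fun i => (f (Sum.elim v w i : L) : K)) := by
    intro n L L' f v w
    constructor <;> · ext i; cases i <;> rfl
  induction φ with
  | falsum => intros; rfl
  | equal t₁ t₂ =>
    intro L L' f hf v w
    simp only [BoundedFormula.Realize, (helim f v w).1, (helim f v w).2]
    obtain ⟨z₁, h₁, h₁'⟩ := hf.exists_realize_eq t₁ (Sum.elim v w)
    obtain ⟨z₂, h₂, h₂'⟩ := hf.exists_realize_eq t₂ (Sum.elim v w)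
    rw [h₁, h₁', h₂, h₂', Subtype.val_injective.eq_iff, Subtype.val_injective.eq_iff,
      f.injective.eq_iff]
  | rel R ts =>
    intro L L' f hf v w
    simp only [BoundedFormula.Realize, (helim f v w).1, (helim f v w).2]
    have h := fun i => hf.exists_realize_eq (ts i) (Sum.elim v w)
    choose z hz hz' using h
    simp only [hz, hz']
    rcases R with (R | R) | R
    · exact R.elim
    · cases R with
      | P => exact hf.mem_iff (z 0)
    · exact R.elim
  | imp φ ψ ih₁ ih₂ =>
    intro L L' f hf v w
    simp only [BoundedFormula.realize_imp]
    rw [ih₁ hf, ih₂ hf]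
  | all φ ih =>
    intro L L' f hf v w
    simp only [BoundedFormula.realize_all]
    have key : ∀ {L₁ L₁' : Subfield K} {f₁ : L₁ ≃+* L₁'}, IsAdmissible E κ k f₁ → Extends f₁ f →
        ∀ x : L₁, φ.Realize (fun i => (v i : K)) (Fin.snoc (fun i => (w i : K)) (x : K)) ↔
          φ.Realize (fun i => (f (v i) : K)) (Fin.snoc (fun i => (f (w i) : K)) (f₁ x : K)) := by
      intro L₁ L₁' f₁ hf₁ hext x
      obtain ⟨hle, hext⟩ := hext
      have h1 := ih hf₁ (fun i => ⟨v i, hle (v i).2⟩)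
        (Fin.snoc (fun i => ⟨w i, hle (w i).2⟩) x)
      simp only [hext] at h1
      convert h1 using 2
      · ext i
        refine Fin.lastCases ?_ (fun j => ?_) i <;> simp
      · ext i
        refine Fin.lastCases ?_ (fun j => ?_) i <;> simp [hext]
    constructor
    · intro h y
      obtain ⟨L₁, L₁', f₁, h1, h2, h3⟩ := hf.back hE y
      have := (key h1 h2 (f₁.symm ⟨y, h3⟩)).1 (h _)
      rwa [f₁.apply_symm_apply] at this
    · intro h x
      obtain ⟨L₁, L₁', f₁, h1, h2, h3⟩ := hf.forth hE x
      exact (key h1 h2 ⟨x, h3⟩).2 (h _)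

lemma IsAdmissible.tpP_eq [IsAlgClosed K] {E k : Subfield K} [IsAlgClosed E]
    {κ : Cardinal.{u}} (hE : IsRich E κ) {L L' : Subfield K} {f : L ≃+* L'}
    (hf : IsAdmissible E κ k f) {n : ℕ} {a b : Fin n → K} (ha : ∀ i, a i ∈ L)
    (hab : ∀ i, (f ⟨a i, ha i⟩ : K) = b i) :
    tpP E (k : Set K) b = tpP E (k : Set K) a := by
  let := pairStructure E
  ext χ
  have h := IsAdmissible.realize_iff hE χ hf (fun i => ⟨a i, ha i⟩) Fin.elim0
  simp only [hab] at h
  change χ.Realize b ↔ χ.Realize a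
  rw [Formula.Realize, Formula.Realize]
  convert h.symm using 2

/-! ### Tame instances from families of polynomials -/

lemma realize_polyTerm (E : Subfield K) {β : Type} (q : MvPolynomial β ℤ) (v : β → K) :
    letI := pairStructure E
    (polyTerm q).realize v = aeval v q := by
  let : FirstOrder.Language.ring.Structure K := (FirstOrder.Ring.compatibleRingOfRing K).toStructure
  let : predLang.Structure K := predStructure E
  obtain ⟨p, rfl⟩ := (freeCommRingEquivMvPolynomialInt β).surjective q
  change ((LHom.sumInl : FirstOrder.Language.ring →ᴸ FirstOrder.Language.ring.sum predLang).onTerm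
    _).realize v = _
  rw [LHom.realize_onTerm, RingEquiv.symm_apply_apply]
  let := FirstOrder.Ring.compatibleRingOfRing K
  have h := FirstOrder.Ring.realize_termOfFreeCommRing p v
  refine h.trans ?_
  have h2 : (FreeCommRing.lift v) =
      ((aeval v : MvPolynomial β ℤ →ₐ[ℤ] K) : MvPolynomial β ℤ →+* K).comp
      (freeCommRingEquivMvPolynomialInt β : FreeCommRing β →+* MvPolynomial β ℤ) := by
    ext x
    simp [freeCommRingEquivMvPolynomialInt]
  rw [h2]
  rfl

lemma realize_tameFormula (E : Subfield K) {α : Type} {r m : ℕ}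
    (q : Fin m → MvPolynomial (α ⊕ Fin r) ℤ) (v : α → K) :
    letI := pairStructure E
    (tameFormula r m q).Realize v ↔ ∃ ζ : Fin r → K, (∀ i, ζ i ∈ E) ∧ ζ ≠ 0 ∧
      ∀ j, aeval (Sum.elim v ζ) (q j) = 0 := by
  let := pairStructure E
  unfold tameFormula
  rw [Formula.realize_iExs]
  refine exists_congr fun ζ => ?_
  rw [Formula.realize_inf, Formula.realize_inf, Formula.realize_iInf, Formula.realize_not,
    Formula.realize_iInf, Formula.realize_iInf]
  simp only [Formula.realize_equal, realize_polyTerm, map_zero, Term.realize_var, Sum.elim_inr]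
  refine and_congr (forall_congr' fun i => ?_) (and_congr (not_congr ?_) Iff.rfl)
  · rw [Formula.realize_rel₁]
    rfl
  · rw [funext_iff]; rfl

lemma realizes_instanceAt (E : Subfield K) (A : Set K) {n l : ℕ}
    (φ : pairLang.Formula (Fin n ⊕ Fin l)) (c : Fin l → A) (b : Fin n → K) :
    Realizes E A (instanceAt A φ c) b ↔
      (letI := pairStructure E; φ.Realize (Sum.elim b fun i => (c i : K))) := by
  let := pairStructure E
  unfold Realizes instanceAt
  rw [Formula.Realize, BoundedFormula.realize_subst]
  have h : (fun a => Term.realize b ((Sum.elim (fun i => Term.var i)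
      (fun i => (pairLang.con (c i)).term) : Fin n ⊕ Fin l → pairLang[[A]].Term (Fin n)) a)) =
      Sum.elim b fun i => (c i : K) := by
    ext (i | i)
    · rfl
    · exact Term.realize_constants
  rw [h]
  exact LHom.realize_onFormula (pairLang.lhomWithConstants A) φ

/-- Every family of polynomials over `k` homogeneous in `Z`, possibly infinite, defines a tame
instance: by Noetherianity finitely many members suffice, and their coefficients are substituted
for extra variables of polynomials over `ℤ`. -/
lemma exists_isTameInstance (E k : Subfield K) {n : ℕ} {Θ : Type*} [Finite Θ]
    (Q : Set (MvPolynomial (Fin n ⊕ Θ) k))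
    (hQ : ∀ q ∈ Q, ∃ d,
      IsWeightedHomogeneous (Sum.elim (fun _ => 0) (fun _ => 1) : Fin n ⊕ Θ → ℕ) q d) :
    ∃ χ : pairLang[[(k : Set K)]].Formula (Fin n), IsTameInstance (k : Set K) χ ∧
      ∀ b : Fin n → K, Realizes E (k : Set K) χ b ↔
        ∃ ζ : Θ → K, (∀ θ, ζ θ ∈ E) ∧ ζ ≠ 0 ∧ ∀ q ∈ Q, aeval (Sum.elim b ζ) q = 0 := by
  classical
  obtain ⟨r, ⟨e⟩⟩ := Finite.exists_equiv_fin Θ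
  obtain ⟨s, hsQ, hs⟩ := (Submodule.fg_span_iff_fg_span_finset_subset Q).1
    (IsNoetherian.noetherian (Ideal.span Q))
  have hvanish : ∀ (b : Fin n → K) (ζ : Θ → K), (∀ q ∈ Q, aeval (Sum.elim b ζ) q = 0) ↔
      ∀ q ∈ s, aeval (Sum.elim b ζ) q = 0 := by
    intro b ζ
    refine ⟨fun h q hq => h q (hsQ hq), fun h q hq => ?_⟩
    have h1 : q ∈ Ideal.span (s : Set (MvPolynomial (Fin n ⊕ Θ) k)) :=
      hs.le (Submodule.subset_span hq)
    have h2 : Ideal.span (s : Set (MvPolynomial (Fin n ⊕ Θ) k)) ≤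
        RingHom.ker (aeval (Sum.elim b ζ) : MvPolynomial (Fin n ⊕ Θ) k →ₐ[k] K) :=
      Ideal.span_le.2 h
    exact h2 h1
  -- `0` is added so that the parameter tuple is never empty and `choose!` applies below
  let C : Finset k := insert 0 (s.biUnion fun q => q.support.image fun m => coeff m q)
  have : Nonempty (Fin C.card) := ⟨C.equivFin ⟨0, Finset.mem_insert_self _ _⟩⟩
  let c : Fin C.card → (k : Set K) := fun i => ⟨(C.equivFin.symm i : k), (C.equivFin.symm i : k).2⟩
  have hC : ∀ q ∈ s, ∀ m ∈ q.support, ∃ i, (c i : K) = (coeff m q : k) := by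
    intro q hq m hm
    have : coeff m q ∈ C :=
      Finset.mem_insert_of_mem (Finset.mem_biUnion.2 ⟨q, hq, Finset.mem_image_of_mem _ hm⟩)
    exact ⟨C.equivFin ⟨_, this⟩, by simp [c]⟩
  choose! idx hidx using hC
  let emb : Fin n ⊕ Θ → (Fin n ⊕ Fin C.card) ⊕ Fin r :=
    Sum.elim (fun i => Sum.inl (Sum.inl i)) (fun θ => Sum.inr (e θ))
  let lift : MvPolynomial (Fin n ⊕ Θ) k → MvPolynomial ((Fin n ⊕ Fin C.card) ⊕ Fin r) ℤ :=
    fun q => ∑ m ∈ q.support, X (Sum.inl (Sum.inr (idx q m))) * monomial (m.mapDomain emb) 1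
  let q' : Fin s.card → MvPolynomial ((Fin n ⊕ Fin C.card) ⊕ Fin r) ℤ := fun j =>
    lift (s.equivFin.symm j)
  have hlift : ∀ q ∈ s, ∀ (b : Fin n → K) (ζ : Fin r → K),
      aeval (Sum.elim (Sum.elim b fun i => (c i : K)) ζ) (lift q) =
        aeval (Sum.elim b (ζ ∘ e)) q := by
    intro q hq b ζ
    have hcomp : (Sum.elim (Sum.elim b fun i => (c i : K)) ζ) ∘ emb = Sum.elim b (ζ ∘ e) := by
      ext (i | θ) <;> rfl
    rw [aeval_def _ q, eval₂_eq, map_sum]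
    refine Finset.sum_congr rfl fun m hm => ?_
    rw [map_mul, aeval_X, Sum.elim_inl, Sum.elim_inr, hidx q hq m hm, ← rename_monomial,
      aeval_rename, hcomp, aeval_monomial, map_one, one_mul]
    rfl
  refine ⟨instanceAt (k : Set K) (tameFormula r s.card q') c,
    ⟨C.card, _, c, ⟨r, s.card, q', ?_, rfl⟩,
    rfl⟩, fun b => ?_⟩
  · intro j
    obtain ⟨d, hd⟩ := hQ _ (hsQ (s.equivFin.symm j).2)
    refine ⟨d, ?_⟩
    refine IsWeightedHomogeneous.sum _ _ _ fun m hm => ?_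
    rw [← zero_add d]
    refine IsWeightedHomogeneous.mul ?_ ?_
    · exact isWeightedHomogeneous_X _ _ _
    · refine isWeightedHomogeneous_monomial _ _ _ ?_
      rw [← hd (mem_support_iff.1 hm), Finsupp.weight_apply, Finsupp.weight_apply,
        Finsupp.sum_mapDomain_index (by simp) (by intros; simp [add_mul])]
      refine Finsupp.sum_congr fun i _ => ?_
      rcases i with i | θ <;> rfl
  · rw [realizes_instanceAt, realize_tameFormula]
    constructor
    · rintro ⟨ζ, h1, h2, h3⟩
      refine ⟨ζ ∘ e, fun θ => h1 _, fun h => h2 ?_, (hvanish _ _).2 fun q hq => ?_⟩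
      · ext i
        simpa using congrFun h (e.symm i)
      · rw [← hlift q hq]
        simpa [q'] using h3 (s.equivFin ⟨q, hq⟩)
    · rintro ⟨ζ, h1, h2, h3⟩
      refine ⟨ζ ∘ e.symm, fun θ => h1 _, fun h => h2 ?_, fun j => ?_⟩
      · ext θ
        simpa using congrFun h (e θ)
      · rw [hlift _ (s.equivFin.symm j).2]
        have : (ζ ∘ e.symm) ∘ e = ζ := by ext; simp
        rw [this]
        exact h3 _ (hsQ (s.equivFin.symm j).2)

/-! ### Consequences of saturation -/

/-- In a vanishing sum, non-zero terms cannot have pairwise distinct values. -/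
lemma eq_zero_of_sum_eq_zero_of_valuation_ne {Γ : Type*} [LinearOrderedCommGroupWithZero Γ]
    (v : Valuation K Γ) {ι : Type*} (s : Finset ι) (z : ι → K)
    (hne : ∀ i ∈ s, ∀ j ∈ s, i ≠ j → z i ≠ 0 → z j ≠ 0 → v (z i) ≠ v (z j))
    (hsum : ∑ i ∈ s, z i = 0) : ∀ i ∈ s, z i = 0 := by
  classical
  by_contra! hcon
  obtain ⟨i₁, hi₁, hz₁⟩ := hcon
  obtain ⟨i₀, hi₀, hmax⟩ := s.exists_max_image (fun i => v (z i)) ⟨i₁, hi₁⟩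
  have h0 : v (z i₀) ≠ 0 := fun h =>
    hz₁ ((v.zero_iff).1 (le_zero_iff.1 ((hmax i₁ hi₁).trans h.le)))
  have hlt : v (∑ i ∈ s.erase i₀, z i) < v (z i₀) := by
    refine Valuation.map_sum_lt v h0 fun i hi => ?_
    rw [Finset.mem_erase] at hi
    by_cases hzi : z i = 0
    · rw [hzi, map_zero]; exact zero_lt_iff.2 h0
    · exact lt_of_le_of_ne (hmax i hi.2)
        (hne i hi.2 i₀ hi₀ hi.1 hzi fun h => h0 (by rw [h, map_zero]))
  have : z i₀ = - ∑ i ∈ s.erase i₀, z i := by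
    rw [eq_neg_iff_add_eq_zero, Finset.add_sum_erase s z hi₀, hsum]
  rw [this, Valuation.map_neg] at hlt
  exact lt_irrefl _ hlt

/-- For a valuation trivial on `E`, a finite-dimensional `E`-space takes finitely many values. -/
lemma finite_valuation_span {Γ : Type*} [LinearOrderedCommGroupWithZero Γ] (E : Subfield K)
    (v : Valuation K Γ) (hv : ∀ e ∈ E, e ≠ 0 → v e = 1) (s : Finset K) :
    (v '' (Submodule.span E (s : Set K) : Set K)).Finite := by
  classical
  induction s using Finset.induction_on with
  | empty => simp
  | insert c s hc ih =>
    rw [Finset.coe_insert]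
    have hsub : (v '' (Submodule.span E (insert c (s : Set K)) : Set K) \
        v '' (Submodule.span E (s : Set K) : Set K)).Subsingleton := by
      rintro _ ⟨⟨w₁, hw₁, rfl⟩, hn₁⟩ _ ⟨⟨w₂, hw₂, rfl⟩, hn₂⟩
      have key : ∀ w ∈ Submodule.span E (insert c (s : Set K)),
          v w ∉ v '' (Submodule.span E (s : Set K) : Set K) →
          ∃ w', v w' = v w ∧ w' - c ∈ Submodule.span E (s : Set K) := by
        intro w hw hn
        obtain ⟨e, x, hx, rfl⟩ := Submodule.mem_span_insert.1 hw
        have he : (e : K) ≠ 0 := fun he => hn ⟨x, hx, by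
          have : e = 0 := Subtype.ext he
          rw [this, zero_smul, zero_add]⟩
        refine ⟨(e : K)⁻¹ * (e • c + x), ?_, ?_⟩
        · rw [map_mul, map_inv₀, hv e e.2 he, inv_one, one_mul]
        · have : (e : K)⁻¹ * (e • c + x) - c = e⁻¹ • x := by
            simp only [Subfield.smul_def, smul_eq_mul]
            push_cast
            field_simp
            ring
          rw [this]
          exact Submodule.smul_mem _ _ hx
      obtain ⟨w₁', h₁, h₁'⟩ := key w₁ hw₁ hn₁
      obtain ⟨w₂', h₂, h₂'⟩ := key w₂ hw₂ hn₂
      by_contra hne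
      rw [← h₁, ← h₂] at hne
      have hmem : w₁' - w₂' ∈ Submodule.span E (s : Set K) := by
        simpa using sub_mem h₁' h₂'
      have hval : v (w₁' - w₂') = max (v w₁') (v w₂') := by
        rw [sub_eq_add_neg, Valuation.map_add_of_distinct_val v (by rwa [Valuation.map_neg]),
          Valuation.map_neg]
      rcases max_choice (v w₁') (v w₂') with h | h
      · exact hn₁ ⟨_, hmem, by rw [hval, h, h₁]⟩
      · exact hn₂ ⟨_, hmem, by rw [hval, h, h₂]⟩
    exact (ih.union hsub.finite).subset fun z hz => by
      by_cases h : z ∈ v '' (Submodule.span E (s : Set K) : Set K)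
      · exact Or.inl h
      · exact Or.inr ⟨hz, h⟩

/-- As `E` is integrally closed in `K`, it is an intersection of valuation rings of `K`. -/
lemma exists_valuationSubring {E : Subfield K} [IsAlgClosed E] {t : K} (ht : t ∉ E) :
    ∃ V : ValuationSubring K, E.toSubring ≤ V.toSubring ∧ t ∉ V := by
  have : IsIntegrallyClosedIn E.toSubring K := by
    rw [Subring.isIntegrallyClosedIn_iff]
    intro x hx
    have hx' : IsIntegral E x := hx
    obtain ⟨y, rfl⟩ := minpoly.mem_range_of_degree_eq_one E x
      (IsAlgClosed.degree_eq_one_of_irreducible E (minpoly.irreducible hx'))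
    exact y.2
  exact Subring.exists_le_valuationSubring_of_isIntegrallyClosedIn (R := E.toSubring) ht

/-- For large `N`, the products `t ^ (N i) * c` with `i ≤ d` and `c ∈ s` are `E`-independent: the
`E`-combinations of `s` take finitely many values, and for large `N` no two non-zero ones differ by
a factor `v t ^ (N i)` with `1 ≤ i`. -/
lemma eventually_linearIndependent {E : Subfield K} [IsAlgClosed E] {t : K} (ht : t ∉ E)
    (d : ℕ) (s : Finset K) (hs : LinearIndependent E ((↑) : s → K)) :
    ∀ᶠ N : ℕ in Filter.atTop,
      LinearIndependent E fun p : Fin (d + 1) × s => (t ^ N) ^ (p.1 : ℕ) * (p.2 : K) := by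
  obtain ⟨V, hEV, htV⟩ := exists_valuationSubring ht
  set v := V.valuation with hvdef
  have hv : ∀ e ∈ E, e ≠ 0 → v e = 1 := by
    intro e he he0
    have h1 : v e ≤ 1 := (V.valuation_le_one_iff _).2 (hEV he)
    have h2 : v e⁻¹ ≤ 1 := (V.valuation_le_one_iff _).2 (hEV (show e⁻¹ ∈ E from inv_mem he))
    rw [map_inv₀, inv_le_one₀ (zero_lt_iff.2 ((v.ne_zero_iff).2 he0))] at h2
    exact le_antisymm h1 h2
  have htv : 1 < v t := not_le.1 fun h => htV ((V.valuation_le_one_iff _).1 h)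
  have ht0 : t ≠ 0 := fun h => ht (h ▸ zero_mem E)
  have hfin := finite_valuation_span E v hv s
  set Γ₀ := v '' (Submodule.span E (s : Set K) : Set K) with hΓ₀
  have hbad : {M : ℕ | ∃ γ ∈ Γ₀, ∃ γ' ∈ Γ₀, γ' ≠ 0 ∧ γ = γ' * v t ^ M}.Finite := by
    have : {M : ℕ | ∃ γ ∈ Γ₀, ∃ γ' ∈ Γ₀, γ' ≠ 0 ∧ γ = γ' * v t ^ M} ⊆
        ⋃ γ ∈ Γ₀, ⋃ γ' ∈ Γ₀, {M : ℕ | γ' ≠ 0 ∧ γ = γ' * v t ^ M} := by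
      rintro M ⟨γ, h1, γ', h2, h3⟩
      simp only [Set.mem_iUnion]
      exact ⟨γ, h1, γ', h2, h3⟩
    refine (hfin.biUnion fun γ _ => hfin.biUnion fun γ' _ => Set.Subsingleton.finite ?_).subset this
    rintro M ⟨h1, h2⟩ M' ⟨-, h3⟩
    rw [h2] at h3
    exact pow_right_injective₀ (zero_lt_one.trans htv) htv.ne' (mul_left_cancel₀ h1 h3)
  obtain ⟨B, hB⟩ := hbad.bddAbove
  filter_upwards [Filter.eventually_gt_atTop B] with N hN
  rw [Fintype.linearIndependent_iff]
  intro e hsum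
  let w : Fin (d + 1) → K := fun i => ∑ j : s, e (i, j) • (j : K)
  have hw : ∀ i, w i ∈ Submodule.span E (s : Set K) := fun i =>
    sum_mem fun j _ => Submodule.smul_mem _ _ (Submodule.subset_span j.2)
  have hsum' : ∑ i : Fin (d + 1), w i * (t ^ N) ^ (i : ℕ) = 0 := by
    rw [← hsum, Fintype.sum_prod_type]
    refine Finset.sum_congr rfl fun i _ => ?_
    rw [Finset.sum_mul]
    refine Finset.sum_congr rfl fun j _ => ?_
    simp only [Subfield.smul_def, smul_eq_mul]
    ring
  have hlt : ∀ i j : Fin (d + 1), i < j → w i ≠ 0 → w j ≠ 0 →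
      v (w i * (t ^ N) ^ (i : ℕ)) ≠ v (w j * (t ^ N) ^ (j : ℕ)) := by
    intro i j hij hi hj heq
    have hle : N ≤ N * ((j : ℕ) - i) := Nat.le_mul_of_pos_right _ (Nat.sub_pos_of_lt hij)
    refine absurd (hB (a := N * ((j : ℕ) - i)) ⟨v (w i), ⟨_, hw i, rfl⟩, v (w j), ⟨_, hw j, rfl⟩,
      (v.ne_zero_iff).2 hj, ?_⟩) (not_le.2 (hN.trans_le hle))
    simp only [map_mul, map_pow] at heq
    have hne : (v t ^ N) ^ (i : ℕ) ≠ 0 := pow_ne_zero _ (pow_ne_zero _ ((v.ne_zero_iff).2 ht0))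
    refine mul_right_cancel₀ hne (heq.trans ?_)
    rw [mul_assoc, ← pow_mul, ← pow_mul, ← pow_add, ← mul_add, Nat.sub_add_cancel hij.le]
  have hz := eq_zero_of_sum_eq_zero_of_valuation_ne v Finset.univ _ (fun i _ j _ hij hi hj => by
    rcases lt_or_gt_of_ne hij with h | h
    · exact hlt i j h (left_ne_zero_of_mul hi) (left_ne_zero_of_mul hj)
    · exact (hlt j i h (left_ne_zero_of_mul hj) (left_ne_zero_of_mul hi)).symm) hsum'
  rintro ⟨i, j⟩
  have hwi : w i = 0 := by
    have := hz i (Finset.mem_univ _)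
    exact (mul_eq_zero.1 this).resolve_right (pow_ne_zero _ (pow_ne_zero _ ht0))
  exact Fintype.linearIndependent_iff.1 hs (fun j => e (i, j)) hwi j

/-- Finitely many elements of `E[L]` are `E`-combinations of a finite `E`-independent subset of
`L`. -/
lemma exists_finset_linearIndependent (E L : Subfield K) (Z : Finset K)
    (hZ : ∀ z ∈ Z, z ∈ Algebra.adjoin E (L : Set K)) :
    ∃ s : Finset K, (s : Set K) ⊆ L ∧ LinearIndependent E ((↑) : s → K) ∧
      ∀ z ∈ Z, ∃ e : s → E, z = ∑ j, (e j : K) * j := by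
  obtain ⟨b, hbL, hspan, hind⟩ := exists_linearIndependent E (L : Set K)
  have hZb : ∀ z ∈ Z, z ∈ Submodule.span E b := by
    intro z hz
    rw [hspan]
    have h1 : z ∈ Subalgebra.toSubmodule (Algebra.adjoin E (L : Set K)) := hZ z hz
    rw [Algebra.adjoin_eq_span] at h1
    have h2 : Submonoid.closure (L : Set K) = L.toSubring.toSubmonoid :=
      Submonoid.closure_eq L.toSubring.toSubmonoid
    rw [h2] at h1
    exact h1
  obtain ⟨s, hsb, hs⟩ : ∃ s : Finset K, (s : Set K) ⊆ b ∧
      (Z : Set K) ⊆ Submodule.span E (s : Set K) :=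
    Submodule.subset_span_finite_of_subset_span hZb
  refine ⟨s, hsb.trans hbL,
    hind.comp (Set.inclusion hsb) (Set.inclusion_injective hsb), fun z hz => ?_⟩
  have h3 : z ∈ Submodule.span E (Set.range ((↑) : s → K)) := by
    rw [Subtype.range_coe]; exact hs hz
  obtain ⟨e, he⟩ := (Submodule.mem_span_range_iff_exists_fun E).1 h3
  exact ⟨e, by rw [← he]; rfl⟩

/-- Saturation for families of definable subsets of `K` with the finite intersection property. -/
lemma IsSaturated.exists_forall_mem {E : Subfield K} {κ : Cardinal.{u}} (hsat : IsSaturated E κ)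
    {L : Subfield K} (hL : #L < κ) {I : Type*} (D : I → Set K)
    (hD : ∀ i, ∃ χ : pairLang[[(L : Set K)]].Formula (Fin 1), ∀ v : Fin 1 → K,
      Realizes E (L : Set K) χ v ↔ v 0 ∈ D i)
    (hfip : ∀ s : Finset I, ∃ x, ∀ i ∈ s, x ∈ D i) : ∃ x, ∀ i, x ∈ D i := by
  classical
  choose χ hχ using hD
  obtain ⟨v, hv⟩ := hsat (L : Set K) hL (Set.range χ) (fun s hs => by
    rw [← Set.image_univ] at hs
    obtain ⟨s', -, rfl⟩ := Finset.subset_set_image_iff.1 hs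
    obtain ⟨x, hx⟩ := hfip s'
    refine ⟨fun _ => x, fun ψ hψ => ?_⟩
    obtain ⟨i, hi, rfl⟩ := Finset.mem_image.1 hψ
    exact (hχ i _).2 (hx i hi))
  exact ⟨v 0, fun i => (hχ i v).1 (hv _ ⟨i, rfl⟩)⟩

lemma realizes_not (E : Subfield K) (A : Set K) {n : ℕ} (χ : pairLang[[A]].Formula (Fin n))
    (b : Fin n → K) : Realizes E A (∼χ) b ↔ ¬ Realizes E A χ b := by
  let := pairStructure E
  exact Formula.realize_not

lemma isWeightedHomogeneous_C_mul_X {k : Subfield K} {n : ℕ} {Θ : Type*}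
    (m : Fin n →₀ ℕ) (c : k) (θ : Θ) :
    IsWeightedHomogeneous (Sum.elim (fun _ => 0) (fun _ => 1) : Fin n ⊕ Θ → ℕ)
      (rename Sum.inl (monomial m c) * X (Sum.inr θ)) 1 := by
  rw [← zero_add 1]
  refine IsWeightedHomogeneous.mul ?_ ?_
  · rw [rename_monomial]
    refine isWeightedHomogeneous_monomial _ _ _ ?_
    rw [Finsupp.weight_apply, Finsupp.sum_mapDomain_index (by simp) (by intros; simp [add_mul])]
    simp [Finsupp.sum]
  · exact isWeightedHomogeneous_X _ _ _

lemma IsSaturated.isRich {E : Subfield K} [IsAlgClosed E] (hE : E ≠ ⊤) {κ : Cardinal.{u}}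
    (hκ : ℵ₀ < κ) (hsat : IsSaturated E κ) : IsRich E κ where
  aleph0_lt := hκ
  exists_mem L hL := by
    let D : Option L → Set K := fun o => o.elim (E : Set K) fun c => {(c : K)}ᶜ
    obtain ⟨x, hx⟩ := hsat.exists_forall_mem hL D (fun o => by
      cases o with
      | none =>
        obtain ⟨χ, -, hχ⟩ := exists_isTameInstance E L (n := 1) (Θ := Bool)
          {rename Sum.inl (monomial (Finsupp.single 0 1) 1) * X (Sum.inr true) -
            rename Sum.inl (monomial 0 1) * X (Sum.inr false)} (by
            rintro _ rfl
            exact ⟨1, (isWeightedHomogeneous_C_mul_X _ _ _).sub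
              (isWeightedHomogeneous_C_mul_X _ _ _)⟩)
        refine ⟨χ, fun v => (hχ v).trans ?_⟩
        simp only [Set.mem_singleton_iff, forall_eq, map_sub, map_mul, aeval_rename,
          Sum.elim_comp_inl, aeval_X, Sum.elim_inr, aeval_monomial, map_one, one_mul, sub_eq_zero,
          Finsupp.prod_single_index, pow_zero, pow_one, Finsupp.prod_zero_index]
        constructor
        · rintro ⟨ζ, h1, h2, h3⟩
          have h4 : ζ true ≠ 0 := fun h4 => h2 (by
            ext b
            cases b
            · rw [← h3, h4, mul_zero]; rfl
            · exact h4)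
          have : v 0 = ζ false / ζ true := by rw [← h3]; field_simp
          change v 0 ∈ E
          rw [this]
          exact div_mem (h1 _) (h1 _)
        · intro hv
          refine ⟨fun b => if b then 1 else v 0, ?_, fun h => ?_, ?_⟩
          · intro b
            cases b
            · exact hv
            · exact one_mem E
          · simpa using congrFun h true
          · simp
      | some c =>
        obtain ⟨χ, -, hχ⟩ := exists_isTameInstance E L (n := 1) (Θ := Unit)
          {rename Sum.inl (monomial (Finsupp.single 0 1) 1) * X (Sum.inr ()) -
            rename Sum.inl (monomial 0 c) * X (Sum.inr ())} (by
            rintro _ rfl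
            exact ⟨1, (isWeightedHomogeneous_C_mul_X _ _ _).sub
              (isWeightedHomogeneous_C_mul_X _ _ _)⟩)
        refine ⟨∼χ, fun v => (realizes_not _ _ _ _).trans (not_congr ((hχ v).trans ?_))⟩
        simp only [Set.mem_singleton_iff, forall_eq, map_sub, map_mul, aeval_rename,
          Sum.elim_comp_inl, aeval_X, Sum.elim_inr, aeval_monomial, map_one, one_mul, sub_eq_zero,
          Finsupp.prod_single_index, pow_zero, pow_one, Finsupp.prod_zero_index, mul_one]
        constructor
        · rintro ⟨ζ, h1, h2, h3⟩
          refine mul_right_cancel₀ (fun h => h2 ?_) h3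
          ext; exact h
        · intro h
          exact ⟨fun _ => 1, fun _ => one_mem E,
            fun h => one_ne_zero (congrFun h ()), by rw [h]; rfl⟩)
      (fun s => by
        classical
        have : Infinite E := inferInstance
        have hinf : (E : Set K).Infinite := Set.infinite_coe_iff.1 this
        obtain ⟨x, hxE, hx⟩ := hinf.exists_notMem_finset (s.image fun o => o.elim (0 : K) (↑))
        refine ⟨x, fun i hi => ?_⟩
        cases i with
        | none => exact hxE
        | some c =>
          intro h
          exact hx (Finset.mem_image.2 ⟨some c, hi, (Set.mem_singleton_iff.1 h).symm⟩))
    exact ⟨x, hx none, fun h => hx (some ⟨x, h⟩) rfl⟩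
  exists_notMem_acl L hL := by
    obtain ⟨t, ht⟩ : ∃ t, t ∉ E := by
      by_contra! h
      exact hE (eq_top_iff.2 fun x _ => h x)
    let D : ℕ × {s : Finset K // (s : Set K) ⊆ L ∧ LinearIndependent E ((↑) : s → K)} → Set K :=
      fun i => {x | LinearIndependent E fun p : Fin (i.1 + 1) × i.2.1 => x ^ (p.1 : ℕ) * (p.2 : K)}
    obtain ⟨x, hx⟩ := hsat.exists_forall_mem hL D (fun ⟨d, s, hsL, hs⟩ => by
      obtain ⟨χ, -, hχ⟩ := exists_isTameInstance E L (n := 1) (Θ := Fin (d + 1) × s)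
        {∑ p : Fin (d + 1) × s, rename Sum.inl (monomial (Finsupp.single 0 (p.1 : ℕ))
          ⟨(p.2 : K), hsL p.2.2⟩) * X (Sum.inr p)} (by
          rintro _ rfl
          exact ⟨1, IsWeightedHomogeneous.sum _ _ _ fun p _ => isWeightedHomogeneous_C_mul_X _ _ _⟩)
      refine ⟨∼χ, fun v => (realizes_not _ _ _ _).trans (not_iff_comm.1 (Iff.trans ?_ (hχ v).symm))⟩
      simp only [D, Set.mem_ofPred_eq, Set.mem_singleton_iff, forall_eq, map_sum, map_mul,
        aeval_rename, Sum.elim_comp_inl, aeval_X, Sum.elim_inr, aeval_monomial,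
        Finsupp.prod_single_index, pow_zero]
      rw [Fintype.not_linearIndependent_iff]
      constructor
      · rintro ⟨g, hg, p, hp⟩
        refine ⟨fun p => g p, fun p => (g p).2, fun h => hp (Subtype.ext (congrFun h p)), ?_⟩
        rw [← hg]
        refine Finset.sum_congr rfl fun p _ => ?_
        simp only [Subfield.smul_def, smul_eq_mul]
        change (p.2 : K) * _ * _ = _
        ring
      · rintro ⟨ζ, h1, h2, h3⟩
        obtain ⟨p, hp⟩ := Function.ne_iff.1 h2
        refine ⟨fun p => ⟨ζ p, h1 p⟩, ?_, p, fun h => hp (congrArg Subtype.val h)⟩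
        rw [← h3]
        refine Finset.sum_congr rfl fun p _ => ?_
        simp only [Subfield.smul_def, smul_eq_mul]
        change _ = (p.2 : K) * _ * _
        ring)
      (fun I => by
        have h : ∀ᶠ N : ℕ in Filter.atTop, ∀ i ∈ I, t ^ N ∈ D i :=
          (Filter.eventually_all_finset I).2 fun i _ =>
            eventually_linearIndependent ht i.1 i.2.1 i.2.2.2
        obtain ⟨N, hN⟩ := h.exists
        exact ⟨t ^ N, hN⟩)
    refine ⟨x, fun hmem => ?_⟩
    rw [Set.union_comm, mem_acl_union_iff] at hmem
    obtain ⟨p, hp0, hp⟩ := hmem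
    classical
    obtain ⟨s, hsL, hs, he⟩ := exists_finset_linearIndependent E L
      ((Finset.range (p.natDegree + 1)).image fun i => (p.coeff i : K)) (fun z hz => by
        obtain ⟨i, -, rfl⟩ := Finset.mem_image.1 hz
        exact (p.coeff i).2)
    have he' : ∀ i : Fin (p.natDegree + 1), ∃ e : s → E, (p.coeff i : K) = ∑ j, (e j : K) * j :=
      fun i => he _ (Finset.mem_image.2 ⟨i, Finset.mem_range.2 i.2, rfl⟩)
    choose e he using he'
    have hind := Fintype.linearIndependent_iff.1 (hx (p.natDegree, ⟨s, hsL, hs⟩))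
      (fun q => e q.1 q.2) (by
        rw [← hp, Polynomial.aeval_eq_sum_range, Finset.sum_range, Fintype.sum_prod_type]
        refine Finset.sum_congr rfl fun i _ => ?_
        rw [Algebra.smul_def]
        change _ = (p.coeff i : K) * _
        rw [he, Finset.sum_mul]
        refine Finset.sum_congr rfl fun j _ => ?_
        simp only [Subfield.smul_def, smul_eq_mul]
        ring)
    have hlead : (p.coeff (Fin.last p.natDegree : Fin (p.natDegree + 1)) : K) = 0 := by
      rw [he]
      refine Finset.sum_eq_zero fun j _ => ?_
      have := hind (Fin.last _, j)
      simp only at this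
      rw [this]
      simp
    exact hp0 (Polynomial.leadingCoeff_eq_zero.1 (Subtype.ext hlead))

/-! ### Homogeneous coordinates attached to a tuple -/

/-- The weight on the variables `(X, Z)` that counts the degree in `Z`. -/
def zWeight (α Θ : Type*) : α ⊕ Θ → ℕ := Sum.elim (fun _ => 0) (fun _ => 1)

/-- `(b, ζ')` is a specialisation of `(a, ζ)` over `k`, where `ζ` and `ζ'` are regarded as
homogeneous coordinates: only polynomials homogeneous in `Z` are considered. -/
def Specializes (k : Subfield K) {n : ℕ} {Θ : Type*} (a : Fin n → K) (ζ : Θ → K)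
    (b : Fin n → K) (ζ' : Θ → K) : Prop :=
  ∀ q : MvPolynomial (Fin n ⊕ Θ) k, (∃ d, IsWeightedHomogeneous (zWeight (Fin n) Θ) q d) →
    aeval (Sum.elim a ζ) q = 0 → aeval (Sum.elim b ζ') q = 0

lemma adjoinTuple_le_iff {k : Subfield K} {n : ℕ} {a : Fin n → K} {L : Subfield K} :
    adjoinTuple k a ≤ L ↔ k ≤ L ∧ ∀ i, a i ∈ L := by
  rw [adjoinTuple, Subfield.closure_le, Set.union_subset_iff, Set.range_subset_iff]
  rfl

/-- An algebraic relation over `E · k` among coordinates of `a` can be rewritten with coefficients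
in `λ(k(a))`, the monomials being multiplied by elements of a finite `E`-independent subset `s` of
`k`. -/
lemma exists_relation_of_not_algebraicIndepOn {E k : Subfield K} {n : ℕ} {a : Fin n → K}
    {S : Finset (Fin n)} (hS : ¬ AlgebraicIndepOn (E ⊔ k : Subfield K) a (S : Set (Fin n))) :
    ∃ (D : Finset ((S : Set (Fin n)) →₀ ℕ)) (s : Finset K), (s : Set K) ⊆ k ∧
      LinearIndependent E ((↑) : s → K) ∧ ∃ c : D × s → K,
        (∀ p, c p ∈ lambda E (adjoinTuple k a : Set K)) ∧ (∃ p, c p ≠ 0) ∧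
        ∑ p, c p * ((p.2 : K) * (p.1 : (S : Set (Fin n)) →₀ ℕ).prod fun i r => a i ^ r) = 0 := by
  classical
  rw [AlgebraicIndepOn, algebraicIndependent_iff] at hS
  push Not at hS
  obtain ⟨P, hP, hP0⟩ := hS
  let A := Algebra.adjoin E (k : Set K)
  let N := IntermediateField.adjoin E (k : Set K)
  have hN : ∀ z ∈ E ⊔ k, z ∈ N := by
    have : E ⊔ k ≤ N.toSubfield := sup_le (fun z hz => N.algebraMap_mem ⟨z, hz⟩)
      (fun z hz => IntermediateField.subset_adjoin E _ hz)
    exact this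
  let f : ((S : Set (Fin n)) →₀ ℕ) → N := fun m =>
    ⟨((coeff m P : (E ⊔ k : Subfield K)) : K), hN _ (coeff m P : (E ⊔ k : Subfield K)).2⟩
  obtain ⟨δ, hδ0, hδ⟩ : ∃ δ : K, δ ≠ 0 ∧
      ∀ m ∈ P.support, δ * ((coeff m P : (E ⊔ k : Subfield K)) : K) ∈ A := by
    open scoped IntermediateField.algebraAdjoinAdjoin in
    obtain ⟨δ, hδ⟩ := IsLocalization.exist_integer_multiples (nonZeroDivisors A) P.support f
    refine ⟨((δ : A) : K), fun h => nonZeroDivisors.ne_zero δ.2 (Subtype.ext h : (δ : A) = 0),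
      fun m hm => ?_⟩
    obtain ⟨y, hy⟩ := hδ m hm
    have hy' : (y : K) = (δ : A) * ((coeff m P : (E ⊔ k : Subfield K)) : K) :=
      congrArg (Subtype.val : N → K) hy
    rw [← hy']
    exact y.2
  obtain ⟨s, hsk, hs, he⟩ := exists_finset_linearIndependent E k
    (P.support.image fun m => δ * ((coeff m P : (E ⊔ k : Subfield K)) : K)) (fun z hz => by
      obtain ⟨m, hm, rfl⟩ := Finset.mem_image.1 hz
      exact hδ m hm)
  have he' : ∀ m : P.support, ∃ e : s → E,
      δ * ((coeff m P : (E ⊔ k : Subfield K)) : K) = ∑ j, (e j : K) * j :=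
    fun m => he _ (Finset.mem_image_of_mem _ m.2)
  choose e he using he'
  refine ⟨P.support, s, hsk, hs, exists_lambda_relation (fun p => ?_) ?_⟩
  · have ha : ∀ i, a i ∈ adjoinTuple k a := fun i => Subfield.subset_closure (Or.inr ⟨i, rfl⟩)
    have h1 : ((p.2 : K)) ∈ adjoinTuple k a := Subfield.subset_closure (Or.inl (hsk p.2.2))
    exact (adjoinTuple k a).mul_mem h1 (prod_mem fun i _ => pow_mem (ha i) _)
  · rw [Fintype.not_linearIndependent_iff]
    obtain ⟨m, hm⟩ := MvPolynomial.support_nonempty.2 hP0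
    have hm' : ∃ j, e ⟨m, hm⟩ j ≠ 0 := by
      by_contra! h
      have h1 := he ⟨m, hm⟩
      rw [Finset.sum_eq_zero fun j _ => by rw [h j]; simp] at h1
      refine (mul_ne_zero hδ0 fun h2 => ?_) h1
      exact (mem_support_iff.1 hm) (Subtype.ext h2)
    obtain ⟨j, hj⟩ := hm'
    refine ⟨fun p => e p.1 p.2, ?_, (⟨m, hm⟩, j), hj⟩
    rw [aeval_def, eval₂_eq] at hP
    have h1 : δ * ∑ m ∈ P.support, ((coeff m P : (E ⊔ k : Subfield K)) : K) *
        m.prod (fun i r => a i ^ r) = 0 := mul_eq_zero_of_right _ hP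
    rw [Finset.mul_sum, ← Finset.sum_coe_sort] at h1
    rw [← h1, Fintype.sum_prod_type]
    refine Finset.sum_congr rfl fun m _ => ?_
    rw [← mul_assoc, he, Finset.sum_mul]
    refine Finset.sum_congr rfl fun j _ => ?_
    simp only [Subfield.smul_def, smul_eq_mul]
    ring

/-- Homogeneous coordinates `ζ` in `λ(k(a))` with the following property, for `d = tr(a / E · k)`:
if `(b, ζ')` specialises `(a, ζ)`, with `ζ'` in `E` and `ζ' θ₀ ≠ 0`, then any `d + 1` coordinates
of `b` are dependent over `k` together with the affine coordinates `ζ' / ζ' θ₀`. -/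
lemma exists_coordinates {E k : Subfield K} {n : ℕ} {a : Fin n → K} {d : ℕ}
    (hd : tr (Set.range a) (E ⊔ k) = d) :
    ∃ (Θ : Type u) (_ : Fintype Θ) (ζ : Θ → K),
      (∀ θ, ζ θ ∈ lambda E (adjoinTuple k a : Set K)) ∧ ζ ≠ 0 ∧
      ∀ (b : Fin n → K) (ζ' : Θ → K) (θ₀ : Θ), (∀ θ, ζ' θ ∈ E) → ζ' θ₀ ≠ 0 →
        Specializes k a ζ b ζ' → ∀ S : Finset (Fin n), S.card = d + 1 →
        ¬ AlgebraicIndepOn (Subfield.closure ((k : Set K) ∪ Set.range fun θ => ζ' θ / ζ' θ₀))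
          b (S : Set (Fin n)) := by
  classical
  have hdep : ∀ S : {S : Finset (Fin n) // S.card = d + 1},
      ¬ AlgebraicIndepOn (E ⊔ k : Subfield K) a (S.1 : Set (Fin n)) := by
    intro S hS
    have h1 := AlgebraicIndepOn.card_le_tr hS (S := Set.range a)
      (Set.Subset.trans (by rintro _ ⟨i, -, rfl⟩; exact Or.inr ⟨i, rfl⟩) (subset_acl _))
    rw [hd, S.2] at h1
    have h2 : d + 1 ≤ d := by exact_mod_cast h1
    omega
  choose D s hsk hs c hc hc0 hsum using fun S => exists_relation_of_not_algebraicIndepOn (hdep S)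
  choose p₀ hp₀ using hc0
  -- The coordinates are all products of one entry from each coefficient vector, so that a single
  -- index `θ₀` selects a chart for all the sets `S` at once.
  refine ⟨∀ S, D S × s S, inferInstance, fun θ => ∏ S, c S (θ S),
    fun θ => prod_mem fun S _ => hc S _,
    fun h => ?_, ?_⟩
  · exact Finset.prod_ne_zero_iff.2 (fun S _ => hp₀ S) (congrFun h fun S => p₀ S)
  intro b ζ' θ₀ hζ' hθ₀ hspec S hS hind
  set S' : {S : Finset (Fin n) // S.card = d + 1} := ⟨S, hS⟩ with hS'
  let mon : (p : D S' × s S') → MvPolynomial (Fin n) k := fun p =>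
    monomial (Finsupp.mapDomain Subtype.val (p.1 : (S : Set (Fin n)) →₀ ℕ)) ⟨p.2, hsk S' p.2.2⟩
  have hmon : ∀ (x : Fin n → K) (p : D S' × s S'), aeval x (mon p) =
      (p.2 : K) * (p.1 : (S : Set (Fin n)) →₀ ℕ).prod fun i r => x i ^ r := by
    intro x p
    rw [aeval_monomial, Finsupp.prod_mapDomain_index (by simp) (by intros; rw [pow_add])]
    rfl
  -- the relation for `S`, with the indices other than that of `S` kept as in `θ₀`
  have h1 := hspec (∑ p : D S' × s S', rename Sum.inl (mon p) *
      X (Sum.inr (Function.update θ₀ S' p)))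
    ⟨1, IsWeightedHomogeneous.sum _ _ _ fun p _ => isWeightedHomogeneous_C_mul_X _ _ _⟩ (by
      simp only [map_sum, map_mul, aeval_rename, Sum.elim_comp_inl, aeval_X, Sum.elim_inr, hmon]
      have h2 : ∀ p : D S' × s S', ∏ T, c T (Function.update θ₀ S' p T) =
          c S' p * ∏ T ∈ Finset.univ.erase S', c T (θ₀ T) := by
        intro p
        rw [← Finset.mul_prod_erase _ _ (Finset.mem_univ S'), Function.update_self]
        congr 1
        refine Finset.prod_congr rfl fun T hT => ?_
        rw [Function.update_of_ne (Finset.ne_of_mem_erase hT)]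
      simp only [h2]
      have h3 := congrArg (· * ∏ T ∈ Finset.univ.erase S', c T (θ₀ T)) (hsum S')
      simp only [zero_mul, Finset.sum_mul] at h3
      rw [← h3]
      refine Finset.sum_congr rfl fun p _ => ?_
      ring)
  simp only [map_sum, map_mul, aeval_rename, Sum.elim_comp_inl, aeval_X, Sum.elim_inr, hmon] at h1
  set k₁ := Subfield.closure ((k : Set K) ∪ Set.range fun θ => ζ' θ / ζ' θ₀) with hk₁
  let c' : D S' × s S' → K := fun p => ζ' (Function.update θ₀ S' p) / ζ' θ₀
  have hc'k : ∀ p, c' p * (p.2 : K) ∈ k₁ := fun p => mul_mem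
    (Subfield.subset_closure (Or.inr ⟨_, rfl⟩)) (Subfield.subset_closure (Or.inl (hsk S' p.2.2)))
  let R : MvPolynomial (S : Set (Fin n)) k₁ :=
    ∑ p : D S' × s S', monomial (p.1 : (S : Set (Fin n)) →₀ ℕ) ⟨c' p * (p.2 : K), hc'k p⟩
  have hR : aeval (fun i : (S : Set (Fin n)) => b i) R = 0 := by
    simp only [R, map_sum, aeval_monomial]
    have h2 := congrArg (· / ζ' θ₀) h1
    simp only [zero_div, Finset.sum_div] at h2
    rw [← h2]
    refine Finset.sum_congr rfl fun p _ => ?_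
    change c' p * (p.2 : K) * _ = _
    simp only [c']
    ring
  have hR0 := hind.eq_zero_of_aeval_eq_zero _ hR
  -- the coefficients at one monomial vanish, so `E`-independence of `s S'` kills a coordinate
  -- which equals `1`
  have hcoeff : ∑ j : s S', c' ((θ₀ S').1, j) * (j : K) = 0 := by
    have h2 := congrArg (fun Q => ((coeff ((θ₀ S').1 : (S : Set (Fin n)) →₀ ℕ) Q : k₁) : K)) hR0
    simp only [R, coeff_sum, coeff_monomial, coeff_zero] at h2
    rw [Fintype.sum_prod_type, Finset.sum_eq_single (θ₀ S').1] at h2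
    · simpa using h2
    · intro m _ hm
      refine Finset.sum_eq_zero fun j _ => if_neg fun h => hm (Subtype.ext h)
    · intro h; exact absurd (Finset.mem_univ _) h
  have h3 := Fintype.linearIndependent_iff.1 (hs S')
    (fun j => ⟨c' ((θ₀ S').1, j), div_mem (hζ' _) (hζ' _)⟩) hcoeff (θ₀ S').2
  have h4 : c' (θ₀ S') = 0 := congrArg Subtype.val h3
  simp only [c', Function.update_eq_self] at h4
  exact div_ne_zero hθ₀ hθ₀ h4

lemma Specializes.ne_zero {k : Subfield K} {n : ℕ} {Θ : Type*} {a : Fin n → K} {ζ : Θ → K}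
    {b : Fin n → K} {ζ' : Θ → K} (h : Specializes k a ζ b ζ') {θ₀ : Θ} (hθ₀ : ζ' θ₀ ≠ 0) :
    ζ θ₀ ≠ 0 := by
  intro h0
  apply hθ₀
  have := h (X (Sum.inr θ₀)) ⟨1, isWeightedHomogeneous_X _ _ _⟩ (by simpa using h0)
  simpa using this

/-- Dehomogenisation of a specialisation: in the chart `ζ' θ₀ ≠ 0`, all equations carry over. -/
lemma Specializes.aeval_div_eq_zero {k : Subfield K} {n : ℕ} {Θ : Type*} {a : Fin n → K}
    {ζ : Θ → K} {b : Fin n → K} {ζ' : Θ → K} (h : Specializes k a ζ b ζ') {θ₀ : Θ}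
    (hθ₀ : ζ' θ₀ ≠ 0) {P : MvPolynomial (Fin n ⊕ Θ) k}
    (hP : aeval (Sum.elim a fun θ => ζ θ / ζ θ₀) P = 0) :
    aeval (Sum.elim b fun θ => ζ' θ / ζ' θ₀) P = 0 := by
  classical
  let w := zWeight (Fin n) Θ
  let N := P.support.sup (Finsupp.weight w)
  let Ph : MvPolynomial (Fin n ⊕ Θ) k := ∑ m ∈ P.support,
    monomial (m + Finsupp.single (Sum.inr θ₀) (N - Finsupp.weight w m)) (coeff m P)
  have hle : ∀ m ∈ P.support, Finsupp.weight w m ≤ N := fun m hm => Finset.le_sup hm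
  have hhom : IsWeightedHomogeneous w Ph N := by
    refine IsWeightedHomogeneous.sum _ _ _ fun m hm => isWeightedHomogeneous_monomial _ _ _ ?_
    rw [map_add, Finsupp.weight_apply _ (Finsupp.single _ _), Finsupp.sum_single_index (by simp)]
    have : w (Sum.inr θ₀) = 1 := rfl
    rw [this, smul_eq_mul, mul_one]
    exact Nat.add_sub_cancel' (hle m hm)
  have heval : ∀ (x : Fin n → K) (ξ : Θ → K), ξ θ₀ ≠ 0 → aeval (Sum.elim x ξ) Ph =
      ξ θ₀ ^ N * aeval (Sum.elim x fun θ => ξ θ / ξ θ₀) P := by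
    intro x ξ hξ
    have hy : ∀ i, Sum.elim x (fun θ => ξ θ / ξ θ₀) i = Sum.elim x ξ i / ξ θ₀ ^ w i := by
      rintro (i | θ)
      · simp [w, zWeight]
      · simp [w, zWeight]
    rw [aeval_def _ P, eval₂_eq, map_sum, Finset.mul_sum]
    refine Finset.sum_congr rfl fun m hm => ?_
    rw [aeval_monomial, Finsupp.prod_add_index' (by simp) (by intros; rw [pow_add]),
      Finsupp.prod_single_index (by simp), Sum.elim_inr]
    have h1 : ∏ i ∈ m.support, Sum.elim x (fun θ => ξ θ / ξ θ₀) i ^ m i =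
        (m.prod fun i r => Sum.elim x ξ i ^ r) / ξ θ₀ ^ (Finsupp.weight w m) := by
      rw [Finsupp.weight_apply, Finsupp.prod, Finsupp.sum, ← Finset.prod_pow_eq_pow_sum,
        ← Finset.prod_div_distrib]
      refine Finset.prod_congr rfl fun i _ => ?_
      rw [hy, div_pow, ← pow_mul, smul_eq_mul, mul_comm (w i)]
    rw [h1]
    have h2 : ξ θ₀ ^ N = ξ θ₀ ^ (N - Finsupp.weight w m) * ξ θ₀ ^ (Finsupp.weight w m) := by
      rw [← pow_add, Nat.sub_add_cancel (hle m hm)]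
    rw [h2]
    have h3 : ξ θ₀ ^ (Finsupp.weight w m) ≠ 0 := pow_ne_zero _ hξ
    field_simp
  have h1 := h Ph ⟨N, hhom⟩ (by rw [heval _ _ (h.ne_zero hθ₀), hP, mul_zero])
  rw [heval _ _ hθ₀] at h1
  exact (mul_eq_zero.1 h1).resolve_left (pow_ne_zero _ hθ₀)

/-! ### The rank along a specialisation -/

lemma omega0_mul_add_lt {d d' : ℕ} (h : d' < d) (m m' : ℕ) :
    Ordinal.omega0 * (d' : Ordinal.{u}) + m' < Ordinal.omega0 * d + m := by
  calc Ordinal.omega0 * (d' : Ordinal.{u}) + m' < Ordinal.omega0 * d' + Ordinal.omega0 := by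
        gcongr; exact Ordinal.natCast_lt_omega0 _
    _ = Ordinal.omega0 * ((d' + 1 : ℕ) : Ordinal.{u}) := by push_cast; rw [mul_add, mul_one]
    _ ≤ Ordinal.omega0 * d := by gcongr; exact h
    _ ≤ _ := le_self_add

lemma algebraicIndepOn_image_inr_iff (M : Subfield K) {ι Θ : Type*} (b : ι → K) (η : Θ → K)
    (T : Set Θ) : AlgebraicIndepOn M (Sum.elim b η) (Sum.inr '' T) ↔ AlgebraicIndepOn M η T :=
  (algebraicIndependent_equiv' (Equiv.Set.image (Sum.inr : Θ → ι ⊕ Θ) T Sum.inr_injective) rfl).symm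

/-- Additivity of algebraic independence, for a field `N` with the same algebraic closure as
`M(η_θ : θ ∈ T₁)`. -/
lemma algebraicIndepOn_sumElim_iff {M N : Subfield K} {ι Θ : Type*} {b : ι → K} {η : Θ → K}
    {T₁ : Set Θ} (h : AlgebraicIndepOn M η T₁)
    (hN : acl (N : Set K) = acl ((M : Set K) ∪ η '' T₁)) (T₂ : Finset ι) :
    AlgebraicIndepOn M (Sum.elim b η) (Sum.inl '' (T₂ : Set ι) ∪ Sum.inr '' T₁) ↔
      AlgebraicIndepOn N b (T₂ : Set ι) := by
  classical
  induction T₂ using Finset.induction_on with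
  | empty =>
    simp only [Finset.coe_empty, Set.image_empty, Set.empty_union, algebraicIndepOn_image_inr_iff]
    exact ⟨fun _ => algebraicIndepOn_empty _ _, fun _ => h⟩
  | insert i T hi ih =>
    rw [Finset.coe_insert, Set.image_insert_eq, Set.insert_union,
      algebraicIndepOn_insert_iff _ (by simpa using hi),
      algebraicIndepOn_insert_iff _ (by simpa using hi), ih, Set.image_union, Set.image_image,
      Set.image_image]
    simp only [Sum.elim_inl, Sum.elim_inr]
    rw [← acl_coe_union (N : Set K), hN, acl_coe_union, Set.union_assoc, Set.union_comm (b '' _)]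

/-- Independence lifts along specialisations. -/
lemma AlgebraicIndepOn.of_forall_aeval {M : Subfield K} {ι : Type*} {x y : ι → K}
    (hxy : ∀ P : MvPolynomial ι M, aeval x P = 0 → aeval y P = 0) {T : Set ι}
    (hT : AlgebraicIndepOn M y T) : AlgebraicIndepOn M x T := by
  rw [AlgebraicIndepOn, algebraicIndependent_iff] at hT ⊢
  intro P hP
  refine hT P ?_
  have h := hxy (rename Subtype.val P) (by rw [aeval_rename]; exact hP)
  rwa [aeval_rename] at h

/-- An independent family of maximal size spans. -/
lemma mem_acl_of_card {M : Subfield K} {ι : Type*} {x : ι → K} {T : Finset ι}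
    (hT : AlgebraicIndepOn M x (T : Set ι))
    (hdep : ∀ S : Finset ι, S.card = T.card + 1 → ¬ AlgebraicIndepOn M x (S : Set ι)) (i : ι) :
    x i ∈ acl ((M : Set K) ∪ x '' T) := by
  classical
  by_contra h
  have hi : i ∉ T := fun hi => h (subset_acl _ (Or.inr ⟨i, hi, rfl⟩))
  refine hdep (insert i T) (Finset.card_insert_of_notMem hi) ?_
  rw [Finset.coe_insert, algebraicIndepOn_insert_iff _ (by simpa using hi)]
  exact ⟨hT, h⟩

lemma acl_closure (S : Set K) : acl (Subfield.closure S : Set K) = acl S :=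
  le_antisymm (acl_le (by
    have : Subfield.closure S ≤ acl S := Subfield.closure_le.2 (subset_acl _)
    exact this)) (acl_mono Subfield.subset_closure)

lemma closure_union_range_le_sup {E k : Subfield K} {Θ : Type*} {η : Θ → K} (hη : ∀ θ, η θ ∈ E) :
    Subfield.closure ((k : Set K) ∪ Set.range η) ≤ E ⊔ k := by
  rw [Subfield.closure_le, Set.union_subset_iff, Set.range_subset_iff]
  exact ⟨SetLike.coe_subset_coe.2 le_sup_right, fun θ =>
    (le_sup_left : E ≤ E ⊔ k) (hη θ)⟩

lemma tr_le_of_dependent {E k : Subfield K} {n d : ℕ} {Θ : Type*} {b : Fin n → K} {η : Θ → K}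
    (hη : ∀ θ, η θ ∈ E) (hdep : ∀ S : Finset (Fin n), S.card = d + 1 →
      ¬ AlgebraicIndepOn (Subfield.closure ((k : Set K) ∪ Set.range η)) b (S : Set (Fin n))) :
    tr (Set.range b) (E ⊔ k) ≤ d := by
  obtain ⟨T, hT, hcard, -⟩ := exists_algebraicIndepOn (E ⊔ k) b
  rw [← hcard]
  by_contra hlt
  have hlt' : d + 1 ≤ T.card := by
    rw [not_le] at hlt
    exact_mod_cast hlt
  obtain ⟨S, hST, hS⟩ := Finset.exists_subset_card_eq hlt'
  refine hdep S hS (AlgebraicIndepOn.mono_base (closure_union_range_le_sup hη) ?_)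
  exact AlgebraicIndepOn.mono hT (Finset.coe_subset.2 hST)

lemma mk_acl_union_range_lt {E k : Subfield K} {κ : Cardinal.{u}} (hE : IsRich E κ)
    (hkκ : #k < κ) {ι : Type*} [Finite ι] (x : ι → K) :
    #(acl ((k : Set K) ∪ Set.range x)) < κ := by
  refine mk_acl_lt hE.aleph0_lt ((mk_union_le _ _).trans_lt ?_)
  exact add_lt_of_lt hE.aleph0_lt.le hkκ ((Set.finite_range x).lt_aleph0.trans hE.aleph0_lt)

/-- If `η` in `E` witnesses that any `tr(b / E · k) + 1` coordinates of `b` are dependent, then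
`acl(k, η, b)` is obtained from `acl(k, η)` by adjoining elements independent over `E · k`. Hence
it is free and meets `E` in `acl(λ(k), η)`, and it is `λ`-closed. -/
lemma isFree_acl_union_range [IsAlgClosed K] {E k : Subfield K} [IsAlgClosed E]
    {κ : Cardinal.{u}} (hE : IsRich E κ) (hk : IsLambdaClosed E k) (hkκ : #k < κ)
    {n d : ℕ} {Θ : Type*} [Finite Θ] {b : Fin n → K} {η : Θ → K} (hη : ∀ θ, η θ ∈ E)
    (hd : tr (Set.range b) (E ⊔ k) = d) (hdep : ∀ S : Finset (Fin n), S.card = d + 1 →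
      ¬ AlgebraicIndepOn (Subfield.closure ((k : Set K) ∪ Set.range η)) b (S : Set (Fin n))) :
    IsFree E (acl ((k : Set K) ∪ Set.range (Sum.elim b η))) ∧
    acl ((k : Set K) ∪ Set.range (Sum.elim b η)) ⊓ E ≤
      acl ((lambda E (k : Set K) : Set K) ∪ Set.range η) ∧
    lambda E (adjoinTuple k b : Set K) ≤ acl ((lambda E (k : Set K) : Set K) ∪ Set.range η) := by
  obtain ⟨T, hT, hcard, -⟩ := exists_algebraicIndepOn (E ⊔ k) b
  have hTd : T.card = d := by rw [hd] at hcard; exact_mod_cast hcard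
  have hηE : Set.range η ⊆ E := Set.range_subset_iff.2 hη
  have hb : ∀ i, b i ∈ acl (((k : Set K) ∪ Set.range η) ∪ b '' T) := fun i => by
    have h := mem_acl_of_card (AlgebraicIndepOn.mono_base (closure_union_range_le_sup hη) hT)
      (by rw [hTd]; exact hdep) i
    rwa [← acl_coe_union, acl_closure, acl_coe_union] at h
  have heq : acl ((acl ((k : Set K) ∪ Set.range η) : Set K) ∪ b '' T) =
      acl ((k : Set K) ∪ Set.range (Sum.elim b η)) := by
    rw [acl_coe_union, Set.Sum.elim_range]
    refine le_antisymm (acl_mono ?_) (acl_le ?_)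
    · rintro z ((hz | hz) | ⟨i, -, rfl⟩)
      · exact Or.inl hz
      · exact Or.inr (Or.inr hz)
      · exact Or.inr (Or.inl ⟨i, rfl⟩)
    · rintro z (hz | ⟨i, rfl⟩ | hz)
      · exact subset_acl _ (Or.inl (Or.inl hz))
      · exact hb i
      · exact subset_acl _ (Or.inl (Or.inr hz))
  obtain ⟨h1, h2⟩ := (hk.isFree.acl_union hηE).acl_union_image (acl_acl _) hT
    (acl_le (by
      rintro z (hz | hz)
      · exact subset_acl _ (Or.inr hz)
      · exact subset_acl _ (Or.inl (hηE hz))))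
  rw [heq, hk.isFree.inf_acl_union hηE, ← lambda_eq_inf hk] at h1
  rw [heq] at h2
  refine ⟨h2, h1, (le_inf ?_ (lambda_le _ _)).trans h1⟩
  refine (lambda_mono E ?_).trans
    (h2.isLambdaClosed hE (acl_acl _) (mk_acl_union_range_lt hE hkκ _))
  exact adjoinTuple_le_iff.2 ⟨fun z hz => subset_acl _ (Or.inl hz),
    fun i => subset_acl _ (Or.inr ⟨Sum.inl i, rfl⟩)⟩

lemma Specializes.algebraicIndepOn {E k : Subfield K} (hk : IsLambdaClosed E k) {n : ℕ}
    {Θ : Type*} {a b : Fin n → K}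
    {ζ ζ' : Θ → K} (h : Specializes k a ζ b ζ') {θ₀ : Θ} (hθ₀ : ζ' θ₀ ≠ 0) (hζ' : ∀ θ, ζ' θ ∈ E)
    {T : Set Θ} (hT : AlgebraicIndepOn (lambda E (k : Set K)) (fun θ => ζ' θ / ζ' θ₀) T) :
    AlgebraicIndepOn (lambda E (k : Set K)) (fun θ => ζ θ / ζ θ₀) T := by
  have h1 := algebraicIndepOn_of_lambda hk (fun θ => div_mem (hζ' θ) (hζ' θ₀)) hT
  rw [← algebraicIndepOn_image_inr_iff k b] at h1
  have h2 := AlgebraicIndepOn.of_forall_aeval (fun P hP => h.aeval_div_eq_zero hθ₀ hP) h1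
  rw [algebraicIndepOn_image_inr_iff] at h2
  exact AlgebraicIndepOn.mono_base hk h2

/-- A specialisation that preserves both transcendence degrees preserves types. -/
lemma tpP_eq_of_specializes [IsAlgClosed K] {E k : Subfield K} [IsAlgClosed E]
    {κ : Cardinal.{u}} (hE : IsRich E κ) (hk : IsLambdaClosed E k) (hkκ : #k < κ)
    {n d : ℕ} {Θ : Type*} [Finite Θ] {a b : Fin n → K} {η η' : Θ → K}
    (hη : ∀ θ, η θ ∈ E) (hη' : ∀ θ, η' θ ∈ E)
    (hspec : ∀ P : MvPolynomial (Fin n ⊕ Θ) k,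
      aeval (Sum.elim a η) P = 0 → aeval (Sum.elim b η') P = 0)
    (ha : tr (Set.range a) (E ⊔ k) = d) (hb : tr (Set.range b) (E ⊔ k) = d)
    (hdep : ∀ S : Finset (Fin n), S.card = d + 1 →
      ¬ AlgebraicIndepOn (Subfield.closure ((k : Set K) ∪ Set.range η)) a (S : Set (Fin n)))
    (hdep' : ∀ S : Finset (Fin n), S.card = d + 1 →
      ¬ AlgebraicIndepOn (Subfield.closure ((k : Set K) ∪ Set.range η')) b (S : Set (Fin n)))
    (htr : tr (Set.range η) (lambda E (k : Set K)) = tr (Set.range η') (lambda E (k : Set K)))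
    (hindep : ∀ T : Set Θ, AlgebraicIndepOn (lambda E (k : Set K)) η' T →
      AlgebraicIndepOn (lambda E (k : Set K)) η T) :
    tpP E (k : Set K) b = tpP E (k : Set K) a := by
  classical
  set F := lambda E (k : Set K) with hF
  have hFk : (F : Set K) ⊆ k := hk
  obtain ⟨T₁, hT₁, hcard₁, hspan₁⟩ := exists_algebraicIndepOn F η'
  obtain ⟨T₂, hT₂, hcard₂, -⟩ := exists_algebraicIndepOn (E ⊔ k) b
  have hT₂d : T₂.card = d := by rw [hb] at hcard₂; exact_mod_cast hcard₂
  have hclosure : ∀ ξ : Θ → K, (∀ θ, ξ θ ∈ acl ((F : Set K) ∪ ξ '' T₁)) →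
      acl (Subfield.closure ((k : Set K) ∪ Set.range ξ) : Set K) = acl ((k : Set K) ∪ ξ '' T₁) := by
    intro ξ hξ
    rw [acl_closure]
    refine le_antisymm (acl_union_le (Set.subset_union_left.trans (subset_acl _)) ?_)
      (acl_mono (Set.union_subset_union_right _ (Set.image_subset_range _ _)))
    rintro _ ⟨θ, rfl⟩
    exact acl_mono (Set.union_subset_union_left _ hFk) (hξ θ)
  have hT₁' := hindep _ hT₁
  have hspan₁' : ∀ θ, η θ ∈ acl ((F : Set K) ∪ η '' T₁) := by
    refine mem_acl_of_card hT₁' fun S hS hind => ?_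
    have h := AlgebraicIndepOn.card_le_tr hind (S := Set.range η)
      (((Set.image_subset_range _ _).trans Set.subset_union_right).trans (subset_acl _))
    rw [htr, ← hcard₁, hS] at h
    have h' : T₁.card + 1 ≤ T₁.card := by exact_mod_cast h
    omega
  have hjoint' := (algebraicIndepOn_sumElim_iff (algebraicIndepOn_of_lambda hk hη' hT₁)
    (hclosure η' hspan₁) T₂).2
    (AlgebraicIndepOn.mono_base (closure_union_range_le_sup hη') hT₂)
  have hjoint := AlgebraicIndepOn.of_forall_aeval hspec hjoint'
  have hTa := (algebraicIndepOn_sumElim_iff (algebraicIndepOn_of_lambda hk hη hT₁')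
    (hclosure η hspan₁') T₂).1 hjoint
  have hspan : ∀ i, Sum.elim a η i ∈ acl ((k : Set K) ∪
      Sum.elim a η '' (Sum.inl '' (T₂ : Set (Fin n)) ∪ Sum.inr '' (T₁ : Set Θ))) := by
    rw [Set.image_union, Set.image_image, Set.image_image]
    simp only [Sum.elim_inl, Sum.elim_inr]
    rintro (i | θ)
    · have h := mem_acl_of_card hTa (by rw [hT₂d]; exact hdep) i
      rw [← acl_coe_union, hclosure η hspan₁', acl_coe_union] at h
      rwa [Set.union_comm (a '' _), ← Set.union_assoc]
    · exact acl_mono (Set.union_subset_union hFk Set.subset_union_right) (hspan₁' θ)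
  have hrange : Set.range k.subtype = (k : Set K) := Subtype.range_coe
  have hiso := exists_ringEquiv_acl k k.subtype (Sum.elim a η) (Sum.elim b η') fun P =>
    ⟨hspec P, fun hP => aeval_eq_zero_of_algebraicIndepOn hspec hjoint' hspan hP⟩
  rw [hrange] at hiso
  obtain ⟨e, hek, hex⟩ := hiso
  obtain ⟨hfree, hinf, -⟩ := isFree_acl_union_range hE hk hkκ hη ha hdep
  obtain ⟨hfree', hinf', -⟩ := isFree_acl_union_range hE hk hkκ hη' hb hdep'
  have hkA : k ≤ acl ((k : Set K) ∪ Set.range (Sum.elim a η)) :=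
    fun z hz => subset_acl _ (Or.inl hz)
  have hxA : ∀ i, Sum.elim a η i ∈ acl ((k : Set K) ∪ Set.range (Sum.elim a η)) :=
    fun i => subset_acl _ (Or.inr ⟨i, rfl⟩)
  have hadm : IsAdmissible E κ k e :=
    { acl_left := acl_acl _
      acl_right := acl_acl _
      free_left := hfree
      free_right := hfree'
      mem_iff := by
        refine mem_iff_apply_mem e (U := (F : Set K) ∪ Set.range η)
          (V := (F : Set K) ∪ Set.range η') ?_ ?_ (fun z hz hzE => hinf ⟨hz, hzE⟩)
          (fun z hz hzE => hinf' ⟨hz, hzE⟩)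
        · rintro u (hu | ⟨θ, rfl⟩)
          · have huE : u ∈ E := lambda_le _ _ hu
            refine ⟨hkA (hFk hu), huE, ?_⟩
            rw [hek ⟨u, hFk hu⟩]
            exact huE
          · have h : (e ⟨_, hxA (Sum.inr θ)⟩ : K) ∈ E := by
              rw [hex (Sum.inr θ) (hxA (Sum.inr θ))]
              exact hη' θ
            exact ⟨hxA (Sum.inr θ), hη θ, h⟩
        · rintro v (hv | ⟨θ, rfl⟩)
          · exact ⟨⟨v, hkA (hFk hv)⟩, hek ⟨v, hFk hv⟩ _, lambda_le _ _ hv, lambda_le _ _ hv⟩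
          · exact ⟨⟨η θ, hxA (Sum.inr θ)⟩, hex (Sum.inr θ) _, hη θ, hη' θ⟩
      card_lt := mk_acl_union_range_lt hE hkκ _
      le_left := hkA
      apply_eq := fun x hx => hek ⟨x, hx⟩ _ }
  exact hadm.tpP_eq hE (fun i => hxA (Sum.inl i)) fun i => hex (Sum.inl i) _

/-- The second summand of the rank is finite. -/
lemma exists_tr_lambda_eq_natCast [IsAlgClosed K] {E k : Subfield K} [IsAlgClosed E]
    {κ : Cardinal.{u}} (hE : IsRich E κ) (hk : IsLambdaClosed E k) (hkκ : #k < κ) {n : ℕ}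
    (a : Fin n → K) :
    ∃ m : ℕ, tr (lambda E (adjoinTuple k a : Set K) : Set K) (lambda E (k : Set K)) = m := by
  obtain ⟨d, hd⟩ := lt_aleph0.1 (tr_range_lt_aleph0 (M := E ⊔ k) a)
  obtain ⟨Θ, _, ζ, hζ, hζ0, hslot⟩ := exists_coordinates hd
  obtain ⟨θ₀, hθ₀⟩ := Function.ne_iff.1 hζ0
  have hζE : ∀ θ, ζ θ ∈ E := fun θ => lambda_le _ _ (hζ θ)
  obtain ⟨-, -, h⟩ := isFree_acl_union_range hE hk hkκ (fun θ => div_mem (hζE θ) (hζE θ₀)) hd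
    (hslot a ζ θ₀ hζE hθ₀ fun _ _ hq => hq)
  exact lt_aleph0.1 ((tr_le_of_subset_acl h).trans_lt (tr_range_lt_aleph0 _))

/-- The tame instance expressing specialisation of `(a, ζ)`, for the coordinates `ζ` attached to
`a`. -/
lemma exists_isTameInstance_rk_le [IsAlgClosed K] {E k : Subfield K} [IsAlgClosed E]
    {κ : Cardinal.{u}} (hE : IsRich E κ) (hk : IsLambdaClosed E k) (hkκ : #k < κ) {n : ℕ}
    (a : Fin n → K) :
    ∃ χ, IsTameInstance (k : Set K) χ ∧ Realizes E (k : Set K) χ a ∧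
      ∀ b : Fin n → K, Realizes E (k : Set K) χ b → rk E k b ≤ rk E k a ∧
        (rk E k b = rk E k a → tpP E (k : Set K) b = tpP E (k : Set K) a) := by
  obtain ⟨d, hd⟩ := lt_aleph0.1 (tr_range_lt_aleph0 (M := E ⊔ k) a)
  obtain ⟨m, hm⟩ := exists_tr_lambda_eq_natCast hE hk hkκ a
  obtain ⟨Θ, _, ζ, hζ, hζ0, hslot⟩ := exists_coordinates hd
  have hζE : ∀ θ, ζ θ ∈ E := fun θ => lambda_le _ _ (hζ θ)
  obtain ⟨χ, hχ, hχ'⟩ := exists_isTameInstance E k (n := n) (Θ := Θ)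
    {q | (∃ d, IsWeightedHomogeneous (zWeight (Fin n) Θ) q d) ∧ aeval (Sum.elim a ζ) q = 0}
    fun q hq => hq.1
  refine ⟨χ, hχ, (hχ' a).2 ⟨ζ, hζE, hζ0, fun q hq => hq.2⟩, fun b hb => ?_⟩
  obtain ⟨ζ', hζ'E, hζ'0, hζ'⟩ := (hχ' b).1 hb
  have hspec : Specializes k a ζ b ζ' := fun q hq h => hζ' q ⟨hq, h⟩
  obtain ⟨θ₀, hθ₀⟩ := Function.ne_iff.1 hζ'0
  obtain ⟨d', hd'⟩ := lt_aleph0.1 (tr_range_lt_aleph0 (M := E ⊔ k) b)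
  obtain ⟨m', hm'⟩ := exists_tr_lambda_eq_natCast hE hk hkκ b
  have hηE : ∀ θ, ζ θ / ζ θ₀ ∈ E := fun θ => div_mem (hζE θ) (hζE θ₀)
  have hη'E : ∀ θ, ζ' θ / ζ' θ₀ ∈ E := fun θ => div_mem (hζ'E θ) (hζ'E θ₀)
  have hdep' := hslot b ζ' θ₀ hζ'E hθ₀ hspec
  have hdd : d' ≤ d := by
    have h := tr_le_of_dependent hη'E hdep'
    rw [hd'] at h
    exact_mod_cast h
  simp only [rk, hd, hm, hd', hm', ord_natCast]
  rcases hdd.lt_or_eq with hlt | rfl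
  · have h := omega0_mul_add_lt.{u} hlt m m'
    exact ⟨h.le, fun h' => absurd h' h.ne⟩
  have h1 : tr (lambda E (adjoinTuple k b : Set K) : Set K) (lambda E (k : Set K)) ≤
      tr (Set.range fun θ => ζ' θ / ζ' θ₀) (lambda E (k : Set K)) :=
    tr_le_of_subset_acl (isFree_acl_union_range hE hk hkκ hη'E hd' hdep').2.2
  have h2 : tr (Set.range fun θ => ζ' θ / ζ' θ₀) (lambda E (k : Set K)) ≤
      tr (Set.range fun θ => ζ θ / ζ θ₀) (lambda E (k : Set K)) := by
    obtain ⟨T, hT, hcard, -⟩ := exists_algebraicIndepOn (lambda E (k : Set K))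
      fun θ => ζ' θ / ζ' θ₀
    rw [← hcard]
    exact AlgebraicIndepOn.card_le_tr (hspec.algebraicIndepOn hk hθ₀ hζ'E hT)
      (((Set.image_subset_range _ _).trans Set.subset_union_right).trans (subset_acl _))
  have h3 : tr (Set.range fun θ => ζ θ / ζ θ₀) (lambda E (k : Set K)) ≤
      tr (lambda E (adjoinTuple k a : Set K) : Set K) (lambda E (k : Set K)) := by
    refine tr_le_of_subset_acl ((Set.subset_union_right.trans (subset_acl _)).trans' ?_)
    rintro _ ⟨θ, rfl⟩
    exact div_mem (hζ θ) (hζ θ₀)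
  rw [hm'] at h1
  rw [hm] at h3
  have hmm : m' ≤ m := by exact_mod_cast h1.trans (h2.trans h3)
  refine ⟨by gcongr, fun h => ?_⟩
  have hmm' : m' = m := by
    have h' := add_left_cancel h
    exact_mod_cast h'
  subst hmm'
  exact tpP_eq_of_specializes hE hk hkκ hηE hη'E (fun P hP => hspec.aeval_div_eq_zero hθ₀ hP)
    hd hd' (hslot a ζ θ₀ hζE (hspec.ne_zero hθ₀) fun _ _ hq => hq) hdep'
    ((h3.trans h1).antisymm h2) fun T hT => hspec.algebraicIndepOn hk hθ₀ hζ'E hT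

end ACFPair

theorem propositionP {K : Type u} [Field K] [IsAlgClosed K]
    (E : Subfield K) [IsAlgClosed E] (hE : E ≠ ⊤)
    (κ : Cardinal.{u}) (hκ : Cardinal.aleph0 < κ) (hsat : ACFPair.IsSaturated E κ)
    (k : Subfield K) (hkκ : Cardinal.mk k < κ) (hk : ACFPair.IsLambdaClosed E k)
    {n : ℕ} (a : Fin n → K) :
    ∃ χ : ACFPair.pairLang[[(k : Set K)]].Formula (Fin n),
      ACFPair.IsTameInstance (k : Set K) χ ∧
      χ ∈ ACFPair.tpP E (k : Set K) a ∧
      ∀ b : Fin n → K, ACFPair.Realizes E (k : Set K) χ b →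
        ACFPair.rk E k b ≤ ACFPair.rk E k a ∧
        (ACFPair.rk E k b = ACFPair.rk E k a ↔
          ACFPair.tpP E (k : Set K) b = ACFPair.tpP E (k : Set K) a) := by
  have hrich := hsat.isRich hE hκ
  obtain ⟨χ, hχ, haχ, h⟩ := ACFPair.exists_isTameInstance_rk_le hrich hk hkκ a
  refine ⟨χ, hχ, haχ, fun b hb => ⟨(h b hb).1, (h b hb).2, fun htp => (h b hb).1.antisymm ?_⟩⟩
  -- `a` satisfies the tame instance attached to `b`, because `a` and `b` have the same type
  obtain ⟨χ', -, hbχ', h'⟩ := ACFPair.exists_isTameInstance_rk_le hrich hk hkκ b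
  have haχ' : χ' ∈ ACFPair.tpP E (k : Set K) a := htp ▸ hbχ'
  exact (h' a haχ').1
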